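/- Let $k$ be an algebraically closed field; varieties are defined over $k$. Let $X$ be an irreducible smooth variety (an integral, smooth, separated scheme of finite type over $k$), let $U$ be a nonempty open subset of the affine space $\mathbb A^{d}_k$ ($d\ge 0$), and let $u_0$ be a ($k$-rational) point of $U$. Consider the morphisms $$\alpha\colon X\times_k U\to X,\quad (x,u)\mapsto x,\qquad\qquad \beta\colon X\to X\times_k U,\quad x\mapsto (x,u_0).$$ For an integral scheme $Y$, let $\operatorname{Pic}(Y)$ denote the group of locally principal (Cartier) divisors on $Y$ modulo principal divisors, and for a morphism $\varphi\colon Z\to Y$ of integral schemes let $\varphi^*\colon \operatorname{Pic}(Y)\to\operatorname{Pic}(Z)$ be the homomorphism induced by pulling back local equations along $\varphi$ (after replacing a divisor by a linearly equivalent one whose support does not contain $\varphi(Z)$). Then the homomorphisms $$\alpha^*\colon \operatorname{Pic}(X)\to \operatorname{Pic}(X\times_k U)\qquad\text{and}\qquad \beta^*\colon \operatorname{Pic}(X\times_k U)\to\operatorname{Pic}(X)$$ are mutually inverse group isomorphisms. -/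

import Mathlib

open CategoryTheory CategoryTheory.Limits AlgebraicGeometry

universe u

noncomputable section

namespace AlgebraicGeometry.Scheme

/-- The subgroup `𝒪_{X,x}ˣ` of the group `K(X)ˣ` of nonzero rational functions on an integral
scheme: the rational functions that are regular and invertible at `x`. -/
def unitsAt (X : Scheme.{u}) [IsIntegral X] (x : X) : Subgroup X.functionFieldˣ :=
  (Units.map (algebraMap (X.presheaf.stalk x) X.functionField).toMonoidHom).range

/-- The identification of `𝒪_{X,x}ˣ` with the subgroup `unitsAt X x` of `K(X)ˣ`. -/
def unitsAtEquiv (X : Scheme.{u}) [IsIntegral X] (x : X) :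
    (X.presheaf.stalk x)ˣ ≃* X.unitsAt x :=
  MonoidHom.ofInjective (Units.map_injective
    (f := (algebraMap (X.presheaf.stalk x) X.functionField).toMonoidHom)
    (IsFractionRing.injective _ _))

lemma coe_unitsAtEquiv (X : Scheme.{u}) [IsIntegral X] (x : X) (a : (X.presheaf.stalk x)ˣ) :
    ((X.unitsAtEquiv x a : X.functionFieldˣ) : X.functionField) =
      algebraMap (X.presheaf.stalk x) X.functionField a :=
  rfl

/-- The group `K(X)ˣ / 𝒪_{X,x}ˣ` of germs of locally principal divisors at `x`. -/
def DivisorGerm (X : Scheme.{u}) [IsIntegral X] (x : X) : Type u :=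
  X.functionFieldˣ ⧸ X.unitsAt x

instance (X : Scheme.{u}) [IsIntegral X] (x : X) : CommGroup (X.DivisorGerm x) :=
  QuotientGroup.Quotient.commGroup (X.unitsAt x)

/-- The germ at `x` of the divisor of a nonzero rational function. -/
def divisorGerm (X : Scheme.{u}) [IsIntegral X] (x : X) :
    X.functionFieldˣ →* X.DivisorGerm x :=
  QuotientGroup.mk' (X.unitsAt x)

lemma divisorGerm_surjective (X : Scheme.{u}) [IsIntegral X] (x : X) :
    Function.Surjective (X.divisorGerm x) :=
  QuotientGroup.mk'_surjective _

lemma divisorGerm_eq_one_iff (X : Scheme.{u}) [IsIntegral X] (x : X) (f : X.functionFieldˣ) :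
    X.divisorGerm x f = 1 ↔ f ∈ X.unitsAt x :=
  QuotientGroup.eq_one_iff f

lemma divisorGerm_eq_iff (X : Scheme.{u}) [IsIntegral X] (x : X) (f g : X.functionFieldˣ) :
    X.divisorGerm x f = X.divisorGerm x g ↔ f⁻¹ * g ∈ X.unitsAt x :=
  QuotientGroup.eq

/-- The group of locally principal (Cartier) divisors on an integral scheme `X`, that is, the
group of global sections of the sheaf `K(X)ˣ / 𝒪_Xˣ`, written multiplicatively. A divisor is a
family of classes `D x ∈ K(X)ˣ / 𝒪_{X,x}ˣ` such that every point has an open neighbourhood on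
which all these classes are given by one and the same nonzero rational function (a local
equation of the divisor). -/
def cartierDivisors (X : Scheme.{u}) [IsIntegral X] : Subgroup (∀ x : X, X.DivisorGerm x) where
  carrier := {D | ∀ x : X, ∃ U : X.Opens, x ∈ U ∧ ∃ f : X.functionFieldˣ,
    ∀ y ∈ U, D y = X.divisorGerm y f}
  one_mem' x := ⟨⊤, trivial, 1, fun _ _ => rfl⟩
  mul_mem' {D E} hD hE x := by
    obtain ⟨U, hU, f, hf⟩ := hD x
    obtain ⟨V, hV, g, hg⟩ := hE x
    exact ⟨U ⊓ V, ⟨hU, hV⟩, f * g, fun y hy => by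
      rw [Pi.mul_apply, hf y hy.1, hg y hy.2, map_mul]⟩
  inv_mem' {D} hD x := by
    obtain ⟨U, hU, f, hf⟩ := hD x
    exact ⟨U, hU, f⁻¹, fun y hy => by rw [Pi.inv_apply, hf y hy, map_inv]⟩

/-- The principal divisor of a nonzero rational function. -/
def principalDivisor (X : Scheme.{u}) [IsIntegral X] :
    X.functionFieldˣ →* X.cartierDivisors :=
  (MonoidHom.pi X.divisorGerm).codRestrict X.cartierDivisors
    fun f _ => ⟨⊤, trivial, f, fun _ _ => rfl⟩

/-- The Picard group of an integral scheme: locally principal divisors modulo principal ones. -/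
def Pic (X : Scheme.{u}) [IsIntegral X] : Type u :=
  X.cartierDivisors ⧸ (X.principalDivisor).range

instance (X : Scheme.{u}) [IsIntegral X] : CommGroup X.Pic :=
  QuotientGroup.Quotient.commGroup (X.principalDivisor).range

/-- The class of a locally principal divisor in the Picard group. -/
def divisorClass (X : Scheme.{u}) [IsIntegral X] : X.cartierDivisors →* X.Pic :=
  QuotientGroup.mk' (X.principalDivisor).range

lemma divisorClass_principal (X : Scheme.{u}) [IsIntegral X] (f : X.functionFieldˣ) :
    X.divisorClass (X.principalDivisor f) = 1 :=
  (QuotientGroup.eq_one_iff _).2 ⟨f, rfl⟩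

/-- The divisors on `Y` whose support does not contain the image of the integral scheme `X`
under `φ : X ⟶ Y`, that is, does not contain the image of the generic point of `X`. -/
def divisorsAvoiding {X Y : Scheme.{u}} [IsIntegral X] [IsIntegral Y] (φ : X ⟶ Y) :
    Subgroup Y.cartierDivisors where
  carrier := {D | D.1 (φ (genericPoint X)) = 1}
  one_mem' := rfl
  mul_mem' hD hE := (congrArg₂ (· * ·) hD hE).trans (one_mul 1)
  inv_mem' hD := (congrArg (·⁻¹) hD).trans inv_one

/-- The pullback `f ↦ f ∘ φ` of rational functions along `φ : X ⟶ Y`. It is defined on the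
rational functions on `Y` that are regular and invertible at the image of the generic point of
`X`. -/
def pullbackUnits {X Y : Scheme.{u}} [IsIntegral X] [IsIntegral Y] (φ : X ⟶ Y) :
    Y.unitsAt (φ (genericPoint X)) →* X.functionFieldˣ :=
  (Units.map (φ.stalkMap (genericPoint X)).hom.toMonoidHom).comp
    (Y.unitsAtEquiv (φ (genericPoint X))).symm.toMonoidHom

lemma pullbackUnits_map {X Y : Scheme.{u}} [IsIntegral X] [IsIntegral Y] (φ : X ⟶ Y)
    (a : (Y.presheaf.stalk (φ (genericPoint X)))ˣ) :
    pullbackUnits φ (Y.unitsAtEquiv _ a) =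
      Units.map (φ.stalkMap (genericPoint X)).hom.toMonoidHom a := by
  unfold pullbackUnits
  rw [MonoidHom.comp_apply]
  congr 1
  exact (Y.unitsAtEquiv _).symm_apply_apply a

lemma genericPoint_specializes_map {X Y : Scheme.{u}} [IsIntegral X] (φ : X ⟶ Y) (x : X) :
    φ (genericPoint X) ⤳ φ x :=
  (genericPoint_specializes x).map φ.continuous

lemma unitsAt_le {X Y : Scheme.{u}} [IsIntegral X] [IsIntegral Y] (φ : X ⟶ Y) (x : X) :
    Y.unitsAt (φ x) ≤ Y.unitsAt (φ (genericPoint X)) := by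
  rintro _ ⟨a, rfl⟩
  refine ⟨Units.map
    (Y.presheaf.stalkSpecializes (genericPoint_specializes_map φ x)).hom.toMonoidHom a, ?_⟩
  ext
  exact TopCat.Presheaf.stalkSpecializes_comp_apply Y.presheaf _ _ (a : Y.presheaf.stalk (φ x))

lemma pullbackUnits_mem {X Y : Scheme.{u}} [IsIntegral X] [IsIntegral Y] (φ : X ⟶ Y) (x : X)
    (f : Y.unitsAt (φ (genericPoint X))) (hf : f.1 ∈ Y.unitsAt (φ x)) :
    pullbackUnits φ f ∈ X.unitsAt x := by
  obtain ⟨a, ha⟩ := hf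
  refine ⟨Units.map (φ.stalkMap x).hom.toMonoidHom a, ?_⟩
  have key : f = Y.unitsAtEquiv _ (Units.map
      (Y.presheaf.stalkSpecializes (genericPoint_specializes_map φ x)).hom.toMonoidHom a) := by
    apply Subtype.ext
    rw [← ha]
    ext
    rw [coe_unitsAtEquiv]
    exact (TopCat.Presheaf.stalkSpecializes_comp_apply Y.presheaf _ _
      (a : Y.presheaf.stalk (φ x))).symm
  rw [key, pullbackUnits_map]
  ext
  exact (Scheme.Hom.stalkSpecializes_stalkMap_apply φ _ _ (genericPoint_specializes x) _).symm

/-- A local equation of a divisor in `divisorsAvoiding φ` at a point of the image of `φ` can be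
pulled back along `φ`. -/
lemma mem_unitsAt_of_avoiding {X Y : Scheme.{u}} [IsIntegral X] [IsIntegral Y] (φ : X ⟶ Y)
    (D : divisorsAvoiding φ) (x : X) (f : Y.functionFieldˣ)
    (hf : D.1.1 (φ x) = Y.divisorGerm _ f) : f ∈ Y.unitsAt (φ (genericPoint X)) := by
  obtain ⟨U, hU, g, hg⟩ := D.1.2 (φ x)
  have h1 : g ∈ Y.unitsAt (φ (genericPoint X)) := by
    rw [← divisorGerm_eq_one_iff,
      ← hg _ ((genericPoint_specializes_map φ x).mem_open U.2 hU)]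
    exact D.2
  rw [hg _ hU, divisorGerm_eq_iff] at hf
  simpa using mul_mem h1 (unitsAt_le φ x hf)

/-- The germ at `x` of the pullback `φ^* D` of a divisor whose support does not contain the image
of `φ`: if `f` is a local equation of `D` at `φ x`, then `f ∘ φ` is a local equation of `φ^* D`
at `x`; by `pullbackDivisorGerm_eq`, the choice of `f` does not matter. -/
def pullbackDivisorGerm {X Y : Scheme.{u}} [IsIntegral X] [IsIntegral Y] (φ : X ⟶ Y)
    (D : divisorsAvoiding φ) (x : X) : X.DivisorGerm x :=
  X.divisorGerm x (pullbackUnits φ ⟨(Y.divisorGerm_surjective _ (D.1.1 (φ x))).choose,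
    mem_unitsAt_of_avoiding φ D x _ (Y.divisorGerm_surjective _ (D.1.1 (φ x))).choose_spec.symm⟩)

lemma pullbackDivisorGerm_eq {X Y : Scheme.{u}} [IsIntegral X] [IsIntegral Y] (φ : X ⟶ Y)
    (D : divisorsAvoiding φ) (x : X) (f : Y.functionFieldˣ)
    (hf : D.1.1 (φ x) = Y.divisorGerm _ f) :
    pullbackDivisorGerm φ D x =
      X.divisorGerm x (pullbackUnits φ ⟨f, mem_unitsAt_of_avoiding φ D x f hf⟩) := by
  unfold pullbackDivisorGerm
  rw [divisorGerm_eq_iff, ← map_inv, ← map_mul]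
  refine pullbackUnits_mem φ x _ ?_
  refine (divisorGerm_eq_iff _ _ _ _).1 ?_
  exact (Y.divisorGerm_surjective _ (D.1.1 (φ x))).choose_spec.trans hf

/-- The pullback of divisors along `φ : X ⟶ Y`, defined on the divisors whose support does not
contain the image of `φ`. -/
def pullbackDivisor {X Y : Scheme.{u}} [IsIntegral X] [IsIntegral Y] (φ : X ⟶ Y) :
    divisorsAvoiding φ →* X.cartierDivisors :=
  MonoidHom.mk' (fun D => ⟨pullbackDivisorGerm φ D, fun x => by
      obtain ⟨U, hU, f, hf⟩ := D.1.2 (φ x)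
      exact ⟨φ ⁻¹ᵁ U, hU, pullbackUnits φ ⟨f, mem_unitsAt_of_avoiding φ D x f (hf _ hU)⟩,
        fun y hy => pullbackDivisorGerm_eq φ D y f (hf _ hy)⟩⟩)
    (fun D E => by
      apply Subtype.ext
      funext x
      obtain ⟨f, hf⟩ := Y.divisorGerm_surjective _ (D.1.1 (φ x))
      obtain ⟨g, hg⟩ := Y.divisorGerm_surjective _ (E.1.1 (φ x))
      have h : (D * E).1.1 (φ x) = Y.divisorGerm _ (f * g) := by
        rw [map_mul, hf, hg]; rfl
      change pullbackDivisorGerm φ (D * E) x =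
        pullbackDivisorGerm φ D x * pullbackDivisorGerm φ E x
      rw [pullbackDivisorGerm_eq φ D x f hf.symm, pullbackDivisorGerm_eq φ E x g hg.symm,
        pullbackDivisorGerm_eq φ (D * E) x _ h, ← map_mul, ← map_mul]
      rfl)

lemma principalDivisor_mem_avoiding {X Y : Scheme.{u}} [IsIntegral X] [IsIntegral Y]
    (φ : X ⟶ Y) (f : Y.functionFieldˣ) :
    Y.principalDivisor f ∈ divisorsAvoiding φ ↔ f ∈ Y.unitsAt (φ (genericPoint X)) :=
  divisorGerm_eq_one_iff _ _ f

lemma pullbackDivisor_principal {X Y : Scheme.{u}} [IsIntegral X] [IsIntegral Y]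
    (φ : X ⟶ Y) (f : Y.unitsAt (φ (genericPoint X)))
    (h : Y.principalDivisor f.1 ∈ divisorsAvoiding φ) :
    pullbackDivisor φ ⟨Y.principalDivisor f.1, h⟩ =
      X.principalDivisor (pullbackUnits φ f) := by
  apply Subtype.ext
  funext x
  exact pullbackDivisorGerm_eq φ ⟨Y.principalDivisor f.1, h⟩ x f.1 rfl

/-- Every divisor on `Y` is linearly equivalent to one whose support does not contain the image
of `φ`. -/
lemma exists_avoiding {X Y : Scheme.{u}} [IsIntegral X] [IsIntegral Y] (φ : X ⟶ Y)
    (D : Y.cartierDivisors) :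
    ∃ f : Y.functionFieldˣ, D * Y.principalDivisor f ∈ divisorsAvoiding φ := by
  obtain ⟨g, hg⟩ := Y.divisorGerm_surjective _ (D.1 (φ (genericPoint X)))
  refine ⟨g⁻¹, ?_⟩
  change D.1 (φ (genericPoint X)) * Y.divisorGerm _ g⁻¹ = 1
  rw [← hg, ← map_mul, mul_inv_cancel, map_one]

lemma pullbackDivisor_class_eq {X Y : Scheme.{u}} [IsIntegral X] [IsIntegral Y] (φ : X ⟶ Y)
    (D E : divisorsAvoiding φ) (f : Y.functionFieldˣ)
    (h : E.1 = D.1 * Y.principalDivisor f) :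
    X.divisorClass (pullbackDivisor φ E) = X.divisorClass (pullbackDivisor φ D) := by
  have hf : Y.principalDivisor f ∈ divisorsAvoiding φ := by
    have : Y.principalDivisor f = (D⁻¹ * E).1 := by
      change _ = D.1⁻¹ * E.1
      rw [h, inv_mul_cancel_left]
    exact this ▸ (D⁻¹ * E).2
  have hE : E = D * ⟨_, hf⟩ := Subtype.ext h
  rw [hE, map_mul, pullbackDivisor_principal φ
    ⟨f, (principalDivisor_mem_avoiding φ f).1 hf⟩ hf, map_mul, divisorClass_principal, mul_one]

/-- The class of `φ^* D'`, where `D'` is a divisor linearly equivalent to `D` whose support does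
not contain the image of `φ`; by `pullbackDivisor_class_eq`, the choice of `D'` does not
matter. -/
def pullbackClass {X Y : Scheme.{u}} [IsIntegral X] [IsIntegral Y] (φ : X ⟶ Y) :
    Y.cartierDivisors →* X.Pic :=
  MonoidHom.mk' (fun D => X.divisorClass (pullbackDivisor φ
      ⟨D * Y.principalDivisor (exists_avoiding φ D).choose, (exists_avoiding φ D).choose_spec⟩))
    (fun D E => by
      rw [← map_mul, ← map_mul]
      refine pullbackDivisor_class_eq φ _ _ ((exists_avoiding φ (D * E)).choose *
        ((exists_avoiding φ D).choose * (exists_avoiding φ E).choose)⁻¹) ?_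
      change D * E * _ = (D * _) * (E * _) * _
      simp only [map_mul, map_inv]
      generalize Y.principalDivisor (exists_avoiding φ (D * E)).choose = a
      generalize Y.principalDivisor (exists_avoiding φ D).choose = b
      generalize Y.principalDivisor (exists_avoiding φ E).choose = c
      rw [mul_mul_mul_comm D b E c, mul_assoc (D * E), mul_comm a, mul_inv_cancel_left])

/-- The homomorphism `φ^* : Pic Y → Pic X` of Picard groups associated with a morphism
`φ : X ⟶ Y` of integral schemes: the class of `D` goes to the class of `φ^* D'`, where `D'` is
any divisor linearly equivalent to `D` whose support does not contain the image of `φ`. -/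
def picMap {X Y : Scheme.{u}} [IsIntegral X] [IsIntegral Y] (φ : X ⟶ Y) : Y.Pic →* X.Pic :=
  QuotientGroup.lift (Y.principalDivisor).range (pullbackClass φ) (by
    rintro _ ⟨f, rfl⟩
    have h := pullbackDivisor_class_eq φ 1
      ⟨_, (exists_avoiding φ (Y.principalDivisor f)).choose_spec⟩
      (f * (exists_avoiding φ (Y.principalDivisor f)).choose)
      (by rw [map_mul]; exact (one_mul _).symm)
    rw [map_one, map_one] at h
    exact h)

lemma picMap_divisorClass {X Y : Scheme.{u}} [IsIntegral X] [IsIntegral Y] (φ : X ⟶ Y)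
    (D : divisorsAvoiding φ) :
    picMap φ (Y.divisorClass D.1) = X.divisorClass (pullbackDivisor φ D) :=
  pullbackDivisor_class_eq φ D ⟨_, (exists_avoiding φ D.1).choose_spec⟩ _ rfl

end AlgebraicGeometry.Scheme

/-- Affine `d`-space over the field `k`. -/
abbrev affineSpaceOver (k : Type u) [Field k] (d : ℕ) : Scheme.{u} :=
  AffineSpace (ULift.{u} (Fin d)) (Spec (.of k))

/-- The structure morphism of an open subscheme of affine `d`-space over `k`. -/
abbrev openAffineSpaceHom {k : Type u} [Field k] {d : ℕ} (U : (affineSpaceOver k d).Opens) :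
    (U : Scheme.{u}) ⟶ Spec (.of k) :=
  U.ι ≫ (affineSpaceOver k d ↘ Spec (.of k))

/-- The product `X × U` over `k` of an integral `k`-scheme and a nonempty open subscheme of affine
space is integral. -/
instance isIntegral_prod_open {k : Type u} [Field k] {d : ℕ} {X : Scheme.{u}} [IsIntegral X]
    (s : X ⟶ Spec (.of k)) (U : (affineSpaceOver k d).Opens) [Nonempty U] :
    IsIntegral (pullback s (openAffineSpaceHom U)) := by
  have h1 : IsIntegral (pullback s (affineSpaceOver k d ↘ Spec (.of k))) := by
    let e := (IsPullback.of_hasPullback s (affineSpaceOver k d ↘ Spec (.of k))).isoIsPullback _ _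
      (AffineSpace.isPullback_map (n := ULift.{u} (Fin d)) s).flip
    exact isIntegral_of_isOpenImmersion e.hom
  have h2 : Surjective (openAffineSpaceHom U) :=
    ⟨fun y => ⟨Classical.arbitrary U, Subsingleton.elim _ _⟩⟩
  have h3 : Nonempty ↥(pullback s (openAffineSpaceHom U)) := by
    obtain ⟨x⟩ : Nonempty X := inferInstance
    obtain ⟨y, -⟩ := (pullback.fst s (openAffineSpaceHom U)).surjective x
    exact ⟨y⟩
  exact isIntegral_of_isOpenImmersion (pullback.map s (openAffineSpaceHom U) s
    (affineSpaceOver k d ↘ Spec (.of k)) (𝟙 X) U.ι (𝟙 _) (by simp) (by simp))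

end

/-! The product Y = X × U is an open subscheme, via j, of affine space over X. Then α is the
projection π = `baseHom j`, and β is a section of π. Functoriality gives β^* α^* = id, so everything
rests on the surjectivity of α^*. Divisors are compared through their germs at all points, including
non-closed ones; no Weil divisors occur.

The fibre of π over the generic point of X is open in affine space over K = K(X). Since K[T] is
factorial, every divisor on Y becomes trivial on this fibre after multiplication by a principal one
(`exists_mul_principalDivisor_eq_one`). It remains to see that a divisor D trivial on the generic
fibre equals π^* β^* D. The quotient F of the two is trivial on the generic fibre, and β^* F is
trivial; triviality of F follows in two steps.

Along the section (`divisor_section_eq_one`): smoothness makes A = 𝒪_{X,p} integrally closed. A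
local equation f of F at β(p) and its inverse are, up to factors invertible at β(p), polynomials
over K whose product has coefficients in A and whose values on the section are units of A. On the
lines through the point of the section, reversal turns such factors into monic divisors of a monic
polynomial, so their coefficients are integral over A, hence lie in A
(`MvPolynomial.mem_range_map_of_mul_eq_map`). Thus f and f⁻¹ are regular at β(p).

At an arbitrary y (`divisor_eq_one_of_section`): the generic point z of the fibre through y
generizes the point β(π(y)) where the section meets that fibre, so F is trivial at z. A function
regular at z and at the generizations of y on the generic fibre is regular at y, by a Gauss-type
lemma: over a local ring, a polynomial with a unit coefficient is a nonzerodivisor modulo any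
constant (`MvPolynomial.C_dvd_of_C_dvd_mul`). -/

section PolynomialLemmas

/-! ### Polynomials: integrality of factors and a Gauss lemma over local rings -/

/-- If a product of two polynomials over `S` has coefficients in `R`, and both constant terms are
units of `R`, then both factors are integral over `R`. -/
theorem Polynomial.isIntegral_coeff_of_mul_eq_map {R S : Type*} [CommRing R] [CommRing S]
    [IsDomain S] [Algebra R S] (hinj : Function.Injective (algebraMap R S))
    {f g : Polynomial S} {h : Polynomial R} (hfg : f * g = h.map (algebraMap R S))
    (hf : ∃ a : Rˣ, f.coeff 0 = algebraMap R S a) (hg : ∃ b : Rˣ, g.coeff 0 = algebraMap R S b)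
    (i : ℕ) : IsIntegral R (f.coeff i) := by
  obtain ⟨a, ha⟩ := hf
  obtain ⟨b, hb⟩ := hg
  -- After scaling the constant term to 1, reversal makes it the leading coefficient. The point is
  -- that a monic divisor of a monic polynomial over R has integral coefficients.
  have h1 : ∀ (p : Polynomial S) (c : Rˣ), p.coeff 0 = algebraMap R S c →
      (Polynomial.C (algebraMap R S ↑c⁻¹) * p).reverse.Monic := by
    intro p c hc
    have h0 : (Polynomial.C (algebraMap R S ↑c⁻¹) * p).coeff 0 = 1 := by
      rw [Polynomial.coeff_C_mul, hc, ← map_mul, Units.inv_mul, map_one]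
    rw [Polynomial.Monic, Polynomial.reverse_leadingCoeff, Polynomial.trailingCoeff,
      Polynomial.natTrailingDegree_eq_zero.2 (Or.inr (by rw [h0]; exact one_ne_zero)), h0]
  set f' := Polynomial.C (algebraMap R S ↑a⁻¹) * f with hf'
  set g' := Polynomial.C (algebraMap R S ↑b⁻¹) * g with hg'
  set h' := Polynomial.C (↑a⁻¹ * ↑b⁻¹ : R) * h with hh'
  have hfg' : f' * g' = h'.map (algebraMap R S) := by
    rw [hf', hg', hh', Polynomial.map_mul, ← hfg, Polynomial.map_C, map_mul, Polynomial.C_mul]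
    ring
  have hrev : f'.reverse * g'.reverse =
      (Polynomial.reflect (f' * g').natDegree h').map (algebraMap R S) := by
    rw [← Polynomial.reverse_mul_of_domain, Polynomial.reverse, ← Polynomial.reflect_map, hfg']
  have hmon : (Polynomial.reflect (f' * g').natDegree h').Monic :=
    Polynomial.monic_of_injective hinj (hrev ▸ (h1 f a ha).mul (h1 g b hb))
  -- `revAt` is an involution of all of ℕ, fixing the indices above the degree, so this index reads
  -- off coefficient i with no bound on i.
  have key := Polynomial.isIntegral_coeff_of_dvd _ _ hmon (h1 f a ha) (Dvd.intro _ hrev)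
    (Polynomial.revAt f'.natDegree i)
  rw [Polynomial.coeff_reverse, Polynomial.revAt_invol, Polynomial.coeff_C_mul] at key
  have := key.smul (a : R)
  rwa [Algebra.smul_def, ← mul_assoc, ← map_mul, Units.mul_inv, map_one, one_mul] at this

/-- Let `A` be an integrally closed domain with fraction field `K`. If a product of two
polynomials over `K` has coefficients in `A` and both factors take a unit of `A` as value at a
point with coordinates in `A`, then the factors have coefficients in `A`. -/
theorem MvPolynomial.mem_range_map_of_mul_eq_map {A K σ : Type*} [CommRing A] [IsDomain A]
    [IsIntegrallyClosed A] [Field K] [Algebra A K] [IsFractionRing A K]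
    {f g : MvPolynomial σ K} {h : MvPolynomial σ A}
    (hfg : f * g = MvPolynomial.map (algebraMap A K) h) (u : σ → A)
    (hf : ∃ a : Aˣ, MvPolynomial.eval (fun i => algebraMap A K (u i)) f = algebraMap A K a)
    (hg : ∃ a : Aˣ, MvPolynomial.eval (fun i => algebraMap A K (u i)) g = algebraMap A K a) :
    ∃ f' : MvPolynomial σ A, MvPolynomial.map (algebraMap A K) f' = f := by
  let _ := MvPolynomial.algebraMvPolynomial (R := A) (S := K) (σ := σ)
  -- Restriction to the line through u and the generic point: Xᵢ ↦ uᵢ + (Xᵢ − uᵢ)T. At T = 0 it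
  -- gives the value at u, at T = 1 the original polynomial; `TA` is the same substitution over A.
  let TK : MvPolynomial σ K →+* Polynomial (MvPolynomial σ K) :=
    MvPolynomial.eval₂Hom (Polynomial.C.comp MvPolynomial.C) fun i =>
      Polynomial.C (X i - C (algebraMap A K (u i))) * Polynomial.X +
        Polynomial.C (C (algebraMap A K (u i)))
  let TA : MvPolynomial σ A →+* Polynomial (MvPolynomial σ A) :=
    MvPolynomial.eval₂Hom (Polynomial.C.comp MvPolynomial.C) fun i =>
      Polynomial.C (X i - C (u i)) * Polynomial.X + Polynomial.C (C (u i))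
  have hcomp : TK.comp (MvPolynomial.map (algebraMap A K)) =
      (Polynomial.mapRingHom (MvPolynomial.map (algebraMap A K))).comp TA := by
    apply MvPolynomial.ringHom_ext
    · intro r; simp [TK, TA]
    · intro i; simp [TK, TA]
  have h0 : (Polynomial.constantCoeff).comp TK =
      (MvPolynomial.C).comp (MvPolynomial.eval fun i => algebraMap A K (u i)) := by
    apply MvPolynomial.ringHom_ext
    · intro r; simp [TK]
    · intro i; simp [TK]
  have h1 : (Polynomial.evalRingHom 1).comp TK = RingHom.id _ := by
    apply MvPolynomial.ringHom_ext
    · intro r; simp [TK]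
    · intro i; simp [TK]
  have hunit : ∀ p : MvPolynomial σ K,
      (∃ a : Aˣ, MvPolynomial.eval (fun i => algebraMap A K (u i)) p = algebraMap A K a) →
      ∃ a : (MvPolynomial σ A)ˣ, (TK p).coeff 0 = algebraMap _ (MvPolynomial σ K) a.1 := by
    rintro p ⟨a, ha⟩
    refine ⟨Units.map (MvPolynomial.C (σ := σ)).toMonoidHom a, ?_⟩
    have := RingHom.congr_fun h0 p
    simp only [RingHom.comp_apply, ha] at this
    rw [Polynomial.constantCoeff_apply] at this
    rw [this]
    exact (MvPolynomial.map_C (algebraMap A K) (a : A)).symm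
  have hint := Polynomial.isIntegral_coeff_of_mul_eq_map (R := MvPolynomial σ A)
    (S := MvPolynomial σ K) (f := TK f) (g := TK g) (h := TA h)
    (MvPolynomial.map_injective _ (IsFractionRing.injective A K))
    (by rw [← map_mul, hfg]; exact RingHom.congr_fun hcomp h) (hunit f hf) (hunit g hg)
  -- Putting T = 1 writes f as the sum of the coefficients of `TK f`, each integral over A[X].
  have hf1 : IsIntegral (MvPolynomial σ A) f := by
    have := RingHom.congr_fun h1 f
    rw [RingHom.comp_apply, RingHom.id_apply, Polynomial.coe_evalRingHom,
      Polynomial.eval_eq_sum, Polynomial.sum] at this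
    rw [← this]
    exact IsIntegral.sum _ fun i _ => by simpa using hint i
  have hc : ∀ m, f.coeff m ∈ Set.range (algebraMap A K) := fun m =>
    IsIntegrallyClosed.isIntegral_iff.1 (MvPolynomial.isIntegral_iff_isIntegral_coeff.1 hf1 m)
  have : f ∈ Set.range (MvPolynomial.map (σ := σ) (algebraMap A K)) := by
    rw [MvPolynomial.mem_range_map_iff_coeffs_subset]
    intro x hx
    obtain ⟨m, -, rfl⟩ := MvPolynomial.mem_coeffs_iff.1 hx
    exact hc m
  exact this

/-- Over a local ring, a polynomial having a unit among its coefficients is a nonzerodivisor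
modulo constants. -/
theorem MvPolynomial.C_dvd_of_C_dvd_mul {A σ : Type*} [CommRing A] [IsLocalRing A] [Finite σ]
    {a h : MvPolynomial σ A} {c : A} (hdvd : C c ∣ a * h) {m₀ : σ →₀ ℕ}
    (hm₀ : IsUnit (h.coeff m₀)) : C c ∣ a := by
  classical
  rw [MvPolynomial.C_dvd_iff_dvd_coeff] at hdvd ⊢
  let _ : LinearOrder σ := LinearOrder.lift' (Finite.equivFin σ) (Finite.equivFin σ).injective
  let mo : MonomialOrder σ := MonomialOrder.lex
  let I : Ideal A := Ideal.span (a.coeffs : Set A)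
  let N : Ideal A := Ideal.span {c}
  let 𝔪 := IsLocalRing.maximalIdeal A
  have hmem : ∀ e, a.coeff e ∈ I := by
    intro e
    by_cases he : a.coeff e = 0
    · rw [he]; exact zero_mem _
    · exact Ideal.subset_span (MvPolynomial.coeff_mem_coeffs e he)
  -- Nakayama for the content ideal I of a: the goal I ≤ (c) may be checked modulo 𝔪I.
  suffices H : ∀ e, a.coeff e ∈ N ⊔ 𝔪 • I by
    have hle : I ≤ N := by
      refine Submodule.le_of_le_smul_of_le_jacobson_bot (I := 𝔪) ⟨a.coeffs, rfl⟩
        (IsLocalRing.maximalIdeal_le_jacobson _) ?_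
      refine Ideal.span_le.2 fun x hx => ?_
      obtain ⟨m, -, rfl⟩ := MvPolynomial.mem_coeffs_iff.1 hx
      exact H m
    exact fun e => Ideal.mem_span_singleton.1 (hle (hmem e))
  -- the largest exponent of a unit coefficient of `h`
  let S := h.support.filter fun m => IsUnit (h.coeff m)
  have hS : S.Nonempty := ⟨m₀, Finset.mem_filter.2
    ⟨MvPolynomial.mem_support_iff.2 hm₀.ne_zero, hm₀⟩⟩
  obtain ⟨m₁, hm₁, hmax⟩ := S.exists_max_image mo.toSyn hS
  have hu₁ : IsUnit (h.coeff m₁) := (Finset.mem_filter.1 hm₁).2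
  by_contra! hcon
  let T := a.support.filter fun e => a.coeff e ∉ N ⊔ 𝔪 • I
  have hT : T.Nonempty := by
    obtain ⟨e, he⟩ := hcon
    refine ⟨e, Finset.mem_filter.2 ⟨MvPolynomial.mem_support_iff.2 fun h0 => he ?_, he⟩⟩
    rw [h0]; exact zero_mem _
  -- Take e₁ largest among the exponents whose coefficient violates the claim. In the coefficient of
  -- a * h at e₁ + m₁, any other pair has either a larger exponent in a (a coefficient already in N
  -- + 𝔪I) or a larger exponent in h (a coefficient in 𝔪). What is left is a unit multiple of the
  -- coefficient of a at e₁.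
  obtain ⟨e₁, he₁, hemax⟩ := T.exists_max_image mo.toSyn hT
  refine (Finset.mem_filter.1 he₁).2 ?_
  have hsum : (a * h).coeff (e₁ + m₁) ∈ N ⊔ 𝔪 • I :=
    Submodule.mem_sup_left (Ideal.mem_span_singleton.2 (hdvd _))
  rw [MvPolynomial.coeff_mul, ← Finset.add_sum_erase _ _
    (show (e₁, m₁) ∈ Finset.HasAntidiagonal.antidiagonal (e₁ + m₁) by simp)] at hsum
  have hrest : ∑ x ∈ (Finset.HasAntidiagonal.antidiagonal (e₁ + m₁)).erase (e₁, m₁),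
      a.coeff x.1 * h.coeff x.2 ∈ N ⊔ 𝔪 • I := by
    refine Submodule.sum_mem _ fun x hx => ?_
    obtain ⟨hne, hx⟩ := Finset.mem_erase.1 hx
    rw [Finset.HasAntidiagonal.mem_antidiagonal] at hx
    have hx' : mo.toSyn x.1 + mo.toSyn x.2 = mo.toSyn e₁ + mo.toSyn m₁ := by
      rw [← map_add, hx, map_add]
    rcases lt_trichotomy (mo.toSyn x.1) (mo.toSyn e₁) with hlt | heq | hgt
    · have hlt2 : mo.toSyn m₁ < mo.toSyn x.2 := by
        by_contra! hle
        exact (add_lt_add_of_lt_of_le hlt hle).ne hx'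
      have hnu : h.coeff x.2 ∈ 𝔪 := by
        rw [IsLocalRing.mem_maximalIdeal, mem_nonunits_iff]
        intro hu
        exact hlt2.not_ge (hmax x.2 (Finset.mem_filter.2
          ⟨MvPolynomial.mem_support_iff.2 hu.ne_zero, hu⟩))
      rw [mul_comm]
      exact Submodule.mem_sup_right (Submodule.smul_mem_smul hnu (hmem _))
    · refine absurd ?_ hne
      have h1 : x.1 = e₁ := mo.toSyn.injective heq
      rw [h1] at hx
      exact Prod.ext h1 (add_left_cancel hx)
    · refine Ideal.mul_mem_right _ _ ?_
      by_contra hnot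
      refine hgt.not_ge (hemax x.1 (Finset.mem_filter.2
        ⟨MvPolynomial.mem_support_iff.2 fun h0 => hnot ?_, hnot⟩))
      rw [h0]; exact zero_mem _
  have hprod := (Submodule.add_mem_iff_left _ hrest).1 hsum
  exact (Ideal.mul_unit_mem_iff_mem _ hu₁).1 hprod

end PolynomialLemmas

/-! ### Normality of smooth algebras over a field -/

section SmoothNormal

open TensorProduct

/-- A domain that is étale over an integrally closed domain is integrally closed. -/
theorem isIntegrallyClosed_of_etale (P S : Type*) [CommRing P] [IsDomain P] [IsIntegrallyClosed P]
    [CommRing S] [IsDomain S] [Algebra P S] [Algebra.Etale P S] : IsIntegrallyClosed S := by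
  let F := FractionRing P
  have hloc : IsLocalization (Algebra.algebraMapSubmonoid S (nonZeroDivisors P)) (S ⊗[P] F) :=
    inferInstance
  have hPS : Function.Injective (algebraMap P S) := FaithfulSMul.algebraMap_injective P S
  have hle : Algebra.algebraMapSubmonoid S (nonZeroDivisors P) ≤ nonZeroDivisors S := by
    rintro _ ⟨p, hp, rfl⟩
    exact mem_nonZeroDivisors_of_ne_zero
      (by simpa using (map_ne_zero_iff _ hPS).2 (nonZeroDivisors.ne_zero hp))
  have hdom : IsDomain (S ⊗[P] F) := IsLocalization.isDomain_of_le_nonZeroDivisors _ hle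
  let e : S ⊗[P] F ≃+* F ⊗[P] S := (Algebra.TensorProduct.comm P S F).toRingEquiv
  have hdom' : IsDomain (F ⊗[P] S) := e.symm.toMulEquiv.isDomain
  -- The generic fibre is unramified, hence finite, over F. Being also a domain, it is a field, and
  -- so it is the fraction field of S.
  have hfin : Module.Finite F (F ⊗[P] S) := Algebra.FormallyUnramified.finite_of_free _ _
  have hfield : IsField (F ⊗[P] S) := isField_of_isIntegral_of_isField' (Field.toIsField F)
  have hfield' : IsField (S ⊗[P] F) := e.toMulEquiv.isField hfield
  let _ := hfield'.toField
  have hinj : Function.Injective (algebraMap S (S ⊗[P] F)) := IsLocalization.injective _ hle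
  have : FaithfulSMul S (S ⊗[P] F) := (faithfulSMul_iff_algebraMap_injective _ _).2 hinj
  have hfrac : IsFractionRing S (S ⊗[P] F) := IsFractionRing.of_field _ _ fun z => by
    obtain ⟨⟨x, y⟩, hz⟩ := IsLocalization.surj (Algebra.algebraMapSubmonoid S (nonZeroDivisors P)) z
    refine ⟨x, y, ?_⟩
    rw [eq_div_iff ((map_ne_zero_iff _ hinj).2 (nonZeroDivisors.ne_zero (hle y.2)))]
    exact hz
  rw [isIntegrallyClosed_iff (S ⊗[P] F)]
  intro x hx
  -- Integral closure commutes with smooth base change, and the integral closure of P in F is P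
  -- itself.
  obtain ⟨t, ht⟩ := (TensorProduct.toIntegralClosure_bijective_of_smooth
    (R := P) (S := S) (B := F)).2 ⟨x, hx⟩
  suffices H : ∀ t, ∃ y, algebraMap S (S ⊗[P] F) y = (TensorProduct.toIntegralClosure P S F t).1 by
    obtain ⟨y, hy⟩ := H t
    exact ⟨y, by rw [hy, ht]⟩
  intro t
  induction t with
  | zero => exact ⟨0, by simp⟩
  | add t₁ t₂ h₁ h₂ =>
    obtain ⟨y₁, h₁⟩ := h₁
    obtain ⟨y₂, h₂⟩ := h₂
    exact ⟨y₁ + y₂, by rw [map_add, map_add, h₁, h₂]; rfl⟩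
  | tmul s b =>
    obtain ⟨p, hp⟩ := IsIntegrallyClosed.isIntegral_iff.1 b.2
    refine ⟨p • s, ?_⟩
    change (p • s) ⊗ₜ[P] (1 : F) = s ⊗ₜ[P] (b : F)
    rw [TensorProduct.smul_tmul, ← hp, Algebra.smul_def, mul_one]

/-- Near each maximal ideal a smooth algebra is étale over a polynomial ring over k, which is
integrally closed. The property passes to the local ring, a further localization, and normality is
checked at maximal ideals. -/
theorem isIntegrallyClosed_of_smooth (k S : Type*) [Field k] [CommRing S] [IsDomain S]
    [Algebra k S] [Algebra.Smooth k S] : IsIntegrallyClosed S := by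
  refine IsIntegrallyClosed.of_localization_maximal fun m _ _ => ?_
  obtain ⟨f, hfm, n, _, _, _⟩ :=
    Algebra.IsSmoothAt.exists_isStandardEtale_mvPolynomial (R := k) (p := m)
  have hf0 : f ≠ 0 := fun h => hfm (h ▸ m.zero_mem)
  have hle : Submonoid.powers f ≤ nonZeroDivisors S :=
    powers_le_nonZeroDivisors_of_noZeroDivisors hf0
  have : IsDomain (Localization.Away f) := IsLocalization.isDomain_localization hle
  have h1 : IsIntegrallyClosed (Localization.Away f) :=
    isIntegrallyClosed_of_etale (MvPolynomial (Fin n) k) _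
  have hle2 : Submonoid.powers f ≤ m.primeCompl :=
    Submonoid.powers_le.2 hfm
  let _ := IsLocalization.localizationAlgebraOfSubmonoidLe (Localization.Away f)
    (Localization.AtPrime m) _ _ hle2
  have := IsLocalization.localization_isScalarTower_of_submonoid_le (Localization.Away f)
    (Localization.AtPrime m) _ _ hle2
  have := IsLocalization.isLocalization_of_submonoid_le (Localization.Away f)
    (Localization.AtPrime m) _ _ hle2
  refine isIntegrallyClosed_of_isLocalization (R := Localization.Away f) _
    (m.primeCompl.map (algebraMap S (Localization.Away f))) ?_
  rintro _ ⟨s, hs, rfl⟩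
  refine mem_nonZeroDivisors_of_ne_zero
    ((map_ne_zero_iff _ (IsLocalization.injective (Localization.Away f) hle)).2 ?_)
  rintro rfl
  exact hs m.zero_mem

end SmoothNormal

/-! ### Functoriality of the pullback on Picard groups -/

namespace AlgebraicGeometry.Scheme

section Functoriality

variable {X Y Z : Scheme.{u}} [IsIntegral X] [IsIntegral Y] [IsIntegral Z]

lemma algebraMap_stalk_injective (x : X) :
    Function.Injective (algebraMap (X.presheaf.stalk x) X.functionField) :=
  IsFractionRing.injective _ _

lemma algebraMap_stalkSpecializes {x y : X} (h : x ⤳ y) (a : X.presheaf.stalk y) :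
    algebraMap (X.presheaf.stalk x) X.functionField (X.presheaf.stalkSpecializes h a) =
      algebraMap (X.presheaf.stalk y) X.functionField a :=
  TopCat.Presheaf.stalkSpecializes_comp_apply X.presheaf _ _ a

lemma unitsAt_mono {x y : X} (h : x ⤳ y) : X.unitsAt y ≤ X.unitsAt x := by
  rintro _ ⟨a, rfl⟩
  refine ⟨Units.map (X.presheaf.stalkSpecializes h).hom.toMonoidHom a, ?_⟩
  ext
  exact algebraMap_stalkSpecializes h a.1

lemma mem_unitsAt_of_isUnit {x : X} {a : X.presheaf.stalk x} (ha : IsUnit a)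
    {f : X.functionFieldˣ} (hf : (f : X.functionField) = algebraMap _ _ a) : f ∈ X.unitsAt x := by
  obtain ⟨a, rfl⟩ := ha
  exact ⟨a, Units.ext hf.symm⟩

/-- The pullback of a rational function that is regular at `φ x` is computed by the map of
stalks at `x`. -/
lemma coe_pullbackUnits (φ : X ⟶ Y) (x : X) (a : Y.presheaf.stalk (φ x))
    (f : Y.unitsAt (φ (genericPoint X)))
    (hf : (f.1 : Y.functionField) = algebraMap _ _ a) :
    (pullbackUnits φ f : X.functionField) = algebraMap _ _ (φ.stalkMap x a) := by
  obtain ⟨b, rfl⟩ := (Y.unitsAtEquiv _).surjective f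
  rw [pullbackUnits_map]
  rw [coe_unitsAtEquiv, ← algebraMap_stalkSpecializes (genericPoint_specializes_map φ x)] at hf
  have hb := IsFractionRing.injective (Y.presheaf.stalk (φ (genericPoint X))) Y.functionField hf
  change φ.stalkMap (genericPoint X) (b : Y.presheaf.stalk _) = _
  rw [hb]
  exact Scheme.Hom.stalkSpecializes_stalkMap_apply φ _ _ (genericPoint_specializes x) a

lemma pullbackUnits_id (f : X.unitsAt ((𝟙 X : X ⟶ X) (genericPoint X))) :
    pullbackUnits (𝟙 X) f = f.1 := by
  obtain ⟨f, a, rfl⟩ := f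
  ext
  rw [coe_pullbackUnits (𝟙 X) (genericPoint X) a.1 _ rfl, Scheme.Hom.stalkMap_id]
  rfl

lemma pullbackUnits_comp (φ : X ⟶ Y) (ψ : Y ⟶ Z) (f : Z.functionFieldˣ)
    (hf : f ∈ Z.unitsAt ((φ ≫ ψ) (genericPoint X)))
    (hf' : f ∈ Z.unitsAt (ψ (genericPoint Y)))
    (hf'' : pullbackUnits ψ ⟨f, hf'⟩ ∈ Y.unitsAt (φ (genericPoint X))) :
    pullbackUnits (φ ≫ ψ) ⟨f, hf⟩ = pullbackUnits φ ⟨pullbackUnits ψ ⟨f, hf'⟩, hf''⟩ := by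
  obtain ⟨a, ha⟩ := id hf
  have ha' : (f : Z.functionField) = algebraMap (Z.presheaf.stalk ((φ ≫ ψ) (genericPoint X))) _
      a.1 := congrArg Units.val ha.symm
  ext
  rw [coe_pullbackUnits (φ ≫ ψ) (genericPoint X) a.1 _ ha',
    coe_pullbackUnits φ (genericPoint X) (ψ.stalkMap (φ (genericPoint X)) a.1) _
      (coe_pullbackUnits ψ (φ (genericPoint X)) a.1 _ ha')]
  rw [Scheme.Hom.stalkMap_comp]
  rfl

/-- A divisor trivial at a point is trivial at all generizations of that point. -/
lemma divisor_eq_one_of_specializes (D : X.cartierDivisors) {x y : X} (h : x ⤳ y)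
    (hD : D.1 y = 1) : D.1 x = 1 := by
  obtain ⟨U, hU, f, hf⟩ := D.2 y
  rw [hf y hU, divisorGerm_eq_one_iff] at hD
  rw [hf x (h.mem_open U.2 hU), divisorGerm_eq_one_iff]
  exact unitsAt_mono h hD

lemma mem_divisorsAvoiding_of_comp (φ : X ⟶ Y) (ψ : Y ⟶ Z) {D : Z.cartierDivisors}
    (hD : D ∈ divisorsAvoiding (φ ≫ ψ)) : D ∈ divisorsAvoiding ψ :=
  divisor_eq_one_of_specializes D (genericPoint_specializes_map ψ (φ (genericPoint X))) hD

/-- The pullback of a divisor is trivial at the points over which the divisor is trivial. -/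
lemma pullbackDivisor_apply_eq_one (φ : X ⟶ Y) (D : divisorsAvoiding φ) (x : X)
    (hD : D.1.1 (φ x) = 1) : (pullbackDivisor φ D).1 x = 1 := by
  refine (pullbackDivisorGerm_eq φ D x 1 (hD.trans (map_one _).symm)).trans ?_
  have h : (⟨1, one_mem _⟩ : Y.unitsAt (φ (genericPoint X))) = 1 := rfl
  rw [show pullbackUnits φ ⟨1, _⟩ = 1 from (congrArg _ h).trans (map_one _), map_one]

lemma pullbackDivisor_mem_divisorsAvoiding (φ : X ⟶ Y) (ψ : Y ⟶ Z) {D : Z.cartierDivisors}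
    (hD : D ∈ divisorsAvoiding (φ ≫ ψ)) :
    pullbackDivisor ψ ⟨D, mem_divisorsAvoiding_of_comp φ ψ hD⟩ ∈ divisorsAvoiding φ :=
  pullbackDivisor_apply_eq_one ψ _ _ hD

lemma pullbackDivisor_comp (φ : X ⟶ Y) (ψ : Y ⟶ Z) {D : Z.cartierDivisors}
    (hD : D ∈ divisorsAvoiding (φ ≫ ψ)) :
    pullbackDivisor (φ ≫ ψ) ⟨D, hD⟩ =
      pullbackDivisor φ ⟨pullbackDivisor ψ ⟨D, mem_divisorsAvoiding_of_comp φ ψ hD⟩,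
        pullbackDivisor_mem_divisorsAvoiding φ ψ hD⟩ := by
  apply Subtype.ext
  funext x
  obtain ⟨f, hf⟩ := Z.divisorGerm_surjective _ (D.1 (ψ (φ x)))
  have h1 := pullbackDivisorGerm_eq (φ ≫ ψ) ⟨D, hD⟩ x f hf.symm
  have h2 := pullbackDivisorGerm_eq ψ ⟨D, mem_divisorsAvoiding_of_comp φ ψ hD⟩ (φ x) f hf.symm
  have h3 := pullbackDivisorGerm_eq φ ⟨pullbackDivisor ψ ⟨D, _⟩,
    pullbackDivisor_mem_divisorsAvoiding φ ψ hD⟩ x _ h2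
  refine h1.trans (Eq.trans ?_ h3.symm)
  congr 1
  exact pullbackUnits_comp φ ψ f _ _ _

lemma pullbackDivisor_id (D : divisorsAvoiding (𝟙 X)) : pullbackDivisor (𝟙 X) D = D.1 := by
  apply Subtype.ext
  funext x
  obtain ⟨f, hf⟩ := X.divisorGerm_surjective _ (D.1.1 x)
  refine (pullbackDivisorGerm_eq (𝟙 X) D x f hf.symm).trans ?_
  rw [pullbackUnits_id]
  exact hf

lemma exists_divisorsAvoiding_divisorClass (φ : X ⟶ Y) (c : Y.Pic) :
    ∃ D : divisorsAvoiding φ, Y.divisorClass D.1 = c := by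
  obtain ⟨D, rfl⟩ := QuotientGroup.mk'_surjective _ c
  obtain ⟨f, hf⟩ := exists_avoiding φ D
  refine ⟨⟨_, hf⟩, ?_⟩
  change Y.divisorClass (D * Y.principalDivisor f) = Y.divisorClass D
  rw [map_mul, divisorClass_principal, mul_one]

/-- A representative avoiding the composite also avoids ψ, because triviality passes to
generizations, and its pullback along ψ avoids φ. One divisor therefore computes all three maps. -/
theorem picMap_comp (φ : X ⟶ Y) (ψ : Y ⟶ Z) :
    picMap (φ ≫ ψ) = (picMap φ).comp (picMap ψ) := by
  ext c
  obtain ⟨D, rfl⟩ := exists_divisorsAvoiding_divisorClass (φ ≫ ψ) c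
  rw [picMap_divisorClass, MonoidHom.comp_apply]
  have h1 := picMap_divisorClass ψ ⟨D.1, mem_divisorsAvoiding_of_comp φ ψ D.2⟩
  have h2 := picMap_divisorClass φ ⟨_, pullbackDivisor_mem_divisorsAvoiding φ ψ D.2⟩
  rw [h1, h2, ← pullbackDivisor_comp]

theorem picMap_id : picMap (𝟙 X) = MonoidHom.id X.Pic := by
  ext c
  obtain ⟨D, rfl⟩ := exists_divisorsAvoiding_divisorClass (𝟙 X) c
  rw [picMap_divisorClass, pullbackDivisor_id, MonoidHom.id_apply]

end Functoriality

end AlgebraicGeometry.Scheme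

/-! ### Functions on affine space over an affine open are polynomials -/

noncomputable section

namespace AlgebraicGeometry.AffineSpace

variable {n : Type u} {X : Scheme.{u}}

/-- The ring homomorphism from polynomials over `Γ(X, W)` to the functions on the part of affine
space over `W`. -/
def polyToSections (n : Type u) (W : X.Opens) :
    MvPolynomial n Γ(X, W) →+* Γ(𝔸(n; X), (𝔸(n; X) ↘ X) ⁻¹ᵁ W) :=
  MvPolynomial.eval₂Hom ((𝔸(n; X) ↘ X).app W).hom
    fun i => (𝔸(n; X)).presheaf.map (homOfLE le_top).op (coord X i)

lemma bijective_eval₂Hom_coord [IsAffine X] :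
    Function.Bijective (MvPolynomial.eval₂Hom ((𝔸(n; X) ↘ X).appTop).hom (coord (n := n) X)) := by
  have h1 : (Scheme.ΓSpecIso _).inv ≫ (isoOfIsAffine n X).hom.appTop =
      CommRingCat.ofHom (MvPolynomial.eval₂Hom ((𝔸(n; X) ↘ X).appTop).hom (coord (n := n) X)) := by
    rw [isoOfIsAffine_hom_appTop, Iso.inv_hom_id_assoc]
  have h2 : IsIso (isoOfIsAffine n X).hom.appTop :=
    inferInstanceAs (IsIso (Scheme.Γ.map (isoOfIsAffine n X).hom.op))
  have h : IsIso (CommRingCat.ofHom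
      (MvPolynomial.eval₂Hom ((𝔸(n; X) ↘ X).appTop).hom (coord (n := n) X))) :=
    h1 ▸ IsIso.comp_isIso
  exact ConcreteCategory.bijective_of_isIso
    (CommRingCat.ofHom (MvPolynomial.eval₂Hom ((𝔸(n; X) ↘ X).appTop).hom (coord (n := n) X)))

lemma isIso_appLE_top {X Y : Scheme.{u}} (f : X ⟶ Y) [IsOpenImmersion f] {V : Y.Opens}
    (hV : f ''ᵁ ⊤ = V) (hle : ⊤ ≤ f ⁻¹ᵁ V) : IsIso (f.appLE V ⊤ hle) := by
  subst hV
  rw [← Scheme.Hom.appIso_hom']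
  infer_instance

lemma app_comp_appLE_of_comm {X Y X' Y' : Scheme.{u}} {f : X ⟶ Y} {f' : X' ⟶ Y'} {g : X' ⟶ X}
    {h : Y' ⟶ Y} (w : g ≫ f = f' ≫ h) {W : Y.Opens} (hg : ⊤ ≤ g ⁻¹ᵁ (f ⁻¹ᵁ W))
    (hh : ⊤ ≤ h ⁻¹ᵁ W) : f.app W ≫ g.appLE (f ⁻¹ᵁ W) ⊤ hg = h.appLE W ⊤ hh ≫ f'.appTop := by
  have hcongr : ∀ {p q : X' ⟶ Y} (_ : p = q) (hp : ⊤ ≤ p ⁻¹ᵁ W) (hq : ⊤ ≤ q ⁻¹ᵁ W),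
      p.appLE W ⊤ hp = q.appLE W ⊤ hq := by
    rintro p _ rfl _ _; rfl
  have hf' : f'.appTop = f'.appLE ⊤ ⊤ le_rfl := f'.app_eq_appLE
  rw [f.app_eq_appLE, hf']
  exact (Scheme.Hom.appLE_comp_appLE g f W _ ⊤ le_rfl hg).trans ((hcongr w _ _).trans
    (Scheme.Hom.appLE_comp_appLE f' h W ⊤ ⊤ hh le_rfl).symm)

lemma presheaf_map_comp_appLE_top {X Y : Scheme.{u}} (f : X ⟶ Y) {V : Y.Opens}
    (hle : ⊤ ≤ f ⁻¹ᵁ V) :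
    Y.presheaf.map (homOfLE le_top : V ⟶ ⊤).op ≫ f.appLE V ⊤ hle = f.appTop := by
  rw [Scheme.Hom.map_appLE]
  exact f.app_eq_appLE.symm

/-- The part of affine space over W is the affine space over W, by base change along `W.ι`; this
reduces the claim to an affine base. -/
lemma bijective_polyToSections {W : X.Opens} (hW : IsAffineOpen W) :
    Function.Bijective (polyToSections n W) := by
  have : IsAffine W := hW
  have hopen : IsOpenImmersion (map n W.ι) :=
    MorphismProperty.of_isPullback (isPullback_map (n := n) W.ι).flip inferInstance
  have hrange : (map n W.ι).opensRange = (𝔸(n; X) ↘ X) ⁻¹ᵁ W := by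
    ext a
    constructor
    · rintro ⟨b, rfl⟩
      change ((map n W.ι) ≫ (𝔸(n; X) ↘ X)) b ∈ W
      rw [map_over]
      exact ((𝔸(n; W) ↘ W) b).2
    · intro ha
      obtain ⟨b, hb, -⟩ := Scheme.exists_preimage_of_isPullback (isPullback_map (n := n) W.ι) a
        ⟨(𝔸(n; X) ↘ X) a, ha⟩ rfl
      exact ⟨b, hb⟩
  have hle : (⊤ : (𝔸(n; W)).Opens) ≤ map n W.ι ⁻¹ᵁ ((𝔸(n; X) ↘ X) ⁻¹ᵁ W) := by
    rw [← hrange]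
    simp
  have hleW : (⊤ : (W : Scheme).Opens) ≤ W.ι ⁻¹ᵁ W := by simp
  let r : Γ(𝔸(n; X), (𝔸(n; X) ↘ X) ⁻¹ᵁ W) ⟶ Γ(𝔸(n; W), ⊤) := (map n W.ι).appLE _ _ hle
  let e : Γ(X, W) ⟶ Γ(W, ⊤) := W.ι.appLE _ _ hleW
  have hr : IsIso r := isIso_appLE_top _ (by rw [← hrange]; exact Scheme.Hom.image_top_eq_opensRange _) _
  have he : IsIso e := isIso_appLE_top _ (by simp) _
  have hcomp : r.hom.comp (polyToSections n W) =
      (MvPolynomial.eval₂Hom ((𝔸(n; W) ↘ W).appTop).hom (coord (n := n) W)).comp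
        (MvPolynomial.map e.hom) := by
    apply MvPolynomial.ringHom_ext
    · intro a
      rw [RingHom.comp_apply, RingHom.comp_apply, MvPolynomial.map_C, polyToSections,
        MvPolynomial.coe_eval₂Hom, MvPolynomial.coe_eval₂Hom, MvPolynomial.eval₂_C,
        MvPolynomial.eval₂_C]
      exact congr($(app_comp_appLE_of_comm (map_over (n := n) W.ι) hle hleW) a)
    · intro i
      rw [RingHom.comp_apply, RingHom.comp_apply, MvPolynomial.map_X, polyToSections,
        MvPolynomial.coe_eval₂Hom, MvPolynomial.coe_eval₂Hom, MvPolynomial.eval₂_X,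
        MvPolynomial.eval₂_X, ← map_appTop_coord W.ι i]
      exact congr($(presheaf_map_comp_appLE_top (map n W.ι) hle) (coord X i))
  have h1 : Function.Bijective (r.hom.comp (polyToSections n W)) := by
    rw [hcomp, RingHom.coe_comp]
    refine bijective_eval₂Hom_coord.comp ?_
    have he' := ConcreteCategory.bijective_of_isIso e
    exact ⟨MvPolynomial.map_injective _ he'.1, MvPolynomial.map_surjective _ he'.2⟩
  rw [RingHom.coe_comp] at h1
  exact (Function.Bijective.of_comp_iff' (ConcreteCategory.bijective_of_isIso r) _).1 h1

end AlgebraicGeometry.AffineSpace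
end

/-! ### Points and local rings of an open subscheme of affine space, through polynomials -/

noncomputable section

namespace AlgebraicGeometry

lemma IsAffineOpen.exists_mul_germ_eq {X : Scheme.{u}} {V : X.Opens} (hV : IsAffineOpen V)
    (x : V) (t : X.presheaf.stalk x.1) : ∃ a s : Γ(X, V), s ∉ (hV.primeIdealOf x).asIdeal ∧
      t * X.presheaf.germ V x.1 x.2 s = X.presheaf.germ V x.1 x.2 a := by
  have hloc := hV.isLocalization_stalk x
  obtain ⟨⟨a, s⟩, h⟩ := IsLocalization.surj (hV.primeIdealOf x).asIdeal.primeCompl t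
  exact ⟨a, s, s.2, h⟩

lemma IsAffineOpen.isUnit_germ_iff {X : Scheme.{u}} {V : X.Opens} (hV : IsAffineOpen V)
    (x : V) (s : Γ(X, V)) :
    IsUnit (X.presheaf.germ V x.1 x.2 s) ↔ s ∉ (hV.primeIdealOf x).asIdeal := by
  have hloc := hV.isLocalization_stalk x
  exact IsLocalization.AtPrime.isUnit_to_map_iff (X.presheaf.stalk x.1)
    (hV.primeIdealOf x).asIdeal s

namespace AffineSpace

variable {n : Type u} {X Y : Scheme.{u}} (j : Y ⟶ 𝔸(n; X))

/-- The projection to the base of a scheme over affine space. -/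
abbrev baseHom : Y ⟶ X := j ≫ 𝔸(n; X) ↘ X

/-- The germ at `y` of a coordinate function. -/
def coordStalk (y : Y) (i : n) : Y.presheaf.stalk y :=
  Y.presheaf.germ ⊤ y trivial (j.appTop (coord X i))

/-- The germs at `y` of polynomials whose coefficients are germs of functions on the base. -/
def stalkPolyStalk (y : Y) :
    MvPolynomial n (X.presheaf.stalk (baseHom j y)) →+* Y.presheaf.stalk y :=
  MvPolynomial.eval₂Hom ((baseHom j).stalkMap y).hom (coordStalk j y)

/-- The germs at `y` of polynomials whose coefficients are functions on an open subset of the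
base. -/
def polyStalk {W : X.Opens} {y : Y} (hy : baseHom j y ∈ W) :
    MvPolynomial n Γ(X, W) →+* Y.presheaf.stalk y :=
  (stalkPolyStalk j y).comp (MvPolynomial.map (X.presheaf.germ W _ hy).hom)

lemma polyStalk_eq {W : X.Opens} {y : Y} (hy : baseHom j y ∈ W) (a : MvPolynomial n Γ(X, W)) :
    polyStalk j hy a = j.stalkMap y ((𝔸(n; X)).presheaf.germ ((𝔸(n; X) ↘ X) ⁻¹ᵁ W) (j y) hy
      (polyToSections n W a)) := by
  refine RingHom.congr_fun (g := (j.stalkMap y).hom.comp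
    (((𝔸(n; X)).presheaf.germ ((𝔸(n; X) ↘ X) ⁻¹ᵁ W) (j y) hy).hom.comp (polyToSections n W))) ?_ a
  apply MvPolynomial.ringHom_ext
  · intro r
    simp only [polyStalk, stalkPolyStalk, polyToSections, RingHom.comp_apply, MvPolynomial.map_C,
      MvPolynomial.coe_eval₂Hom, MvPolynomial.eval₂_C]
    have h1 := Scheme.Hom.germ_stalkMap_apply (baseHom j) W y hy r
    have h2 := Scheme.Hom.germ_stalkMap_apply j ((𝔸(n; X) ↘ X) ⁻¹ᵁ W) y hy
      ((𝔸(n; X) ↘ X).app W r)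
    refine h1.trans (Eq.trans ?_ h2.symm)
    rw [Scheme.Hom.comp_app]
    rfl
  · intro i
    simp only [polyStalk, stalkPolyStalk, polyToSections, RingHom.comp_apply, MvPolynomial.map_X,
      MvPolynomial.coe_eval₂Hom, MvPolynomial.eval₂_X, coordStalk]
    have h1 := Scheme.Hom.germ_stalkMap_apply j ⊤ y trivial (coord X i)
    refine h1.symm.trans ?_
    congr 1
    exact (TopCat.Presheaf.germ_res_apply (𝔸(n; X)).presheaf _ _ _ _).symm

variable {W : X.Opens}

lemma isAffineOpen_preimage (hW : IsAffineOpen W) : IsAffineOpen ((𝔸(n; X) ↘ X) ⁻¹ᵁ W) := hW.preimage _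

lemma isUnit_polyStalk_iff (hW : IsAffineOpen W) {y : Y} (hy : baseHom j y ∈ W) (s : MvPolynomial n Γ(X, W)) :
    IsUnit (polyStalk j hy s) ↔ polyToSections n W s ∉
      ((isAffineOpen_preimage hW).primeIdealOf ⟨j y, hy⟩).asIdeal := by
  rw [polyStalk_eq]
  exact (isUnit_map_iff (j.stalkMap y).hom _).trans
    ((isAffineOpen_preimage hW).isUnit_germ_iff ⟨j y, hy⟩ _)

variable [IsOpenImmersion j]

/-- An open immersion induces isomorphisms on stalks, so the local ring at y is a localization of
the polynomial ring over Γ(X, W). -/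
lemma exists_mul_polyStalk_eq (hW : IsAffineOpen W) {y : Y} (hy : baseHom j y ∈ W) (t : Y.presheaf.stalk y) :
    ∃ a s, IsUnit (polyStalk j hy s) ∧ t * polyStalk j hy s = polyStalk j hy a := by
  obtain ⟨t', rfl⟩ := (ConcreteCategory.bijective_of_isIso (j.stalkMap y)).2 t
  obtain ⟨a, s, hs, h⟩ := (isAffineOpen_preimage hW).exists_mul_germ_eq ⟨j y, hy⟩ t'
  obtain ⟨a, rfl⟩ := (bijective_polyToSections hW).2 a
  obtain ⟨s, rfl⟩ := (bijective_polyToSections hW).2 s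
  refine ⟨a, s, (isUnit_polyStalk_iff j hW hy s).2 hs, ?_⟩
  rw [polyStalk_eq, polyStalk_eq, ← map_mul]
  exact congrArg _ h

lemma specializes_of_isUnit_imp (hW : IsAffineOpen W) {y z : Y} (hy : baseHom j y ∈ W) (hz : baseHom j z ∈ W)
    (h : ∀ g, IsUnit (polyStalk j hy g) → IsUnit (polyStalk j hz g)) : z ⤳ y := by
  rw [← j.isOpenEmbedding.isInducing.specializes_iff]
  have hW' := isAffineOpen_preimage (n := n) hW
  suffices H : hW'.primeIdealOf ⟨j z, hz⟩ ⤳ hW'.primeIdealOf ⟨j y, hy⟩ by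
    have := H.map hW'.fromSpec.continuous
    rwa [hW'.fromSpec_primeIdealOf, hW'.fromSpec_primeIdealOf] at this
  rw [← PrimeSpectrum.le_iff_specializes]
  intro g hg
  obtain ⟨g, rfl⟩ := (bijective_polyToSections hW).2 g
  by_contra hg'
  exact (isUnit_polyStalk_iff j hW hz g).1 (h g ((isUnit_polyStalk_iff j hW hy g).2 hg')) hg

/-- A prime ideal consisting of polynomials vanishing at `y` is the ideal of a generization
of `y`. -/
lemma exists_specializes_of_isPrime (hW : IsAffineOpen W) {y : Y} (hy : baseHom j y ∈ W)
    (P : Ideal (MvPolynomial n Γ(X, W))) [P.IsPrime] (hP : ∀ g ∈ P, ¬ IsUnit (polyStalk j hy g)) :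
    ∃ (z : Y) (hz : baseHom j z ∈ W), z ⤳ y ∧ ∀ g, IsUnit (polyStalk j hz g) ↔ g ∉ P := by
  have hW' := isAffineOpen_preimage (n := n) hW
  let e := RingEquiv.ofBijective _ (bijective_polyToSections (n := n) hW)
  let P' : PrimeSpectrum Γ(𝔸(n; X), (𝔸(n; X) ↘ X) ⁻¹ᵁ W) :=
    ⟨P.comap e.symm.toRingHom, inferInstance⟩
  have hmem : ∀ g, polyToSections n W g ∈ P'.asIdeal ↔ g ∈ P := by
    intro g
    change e.symm (e g) ∈ P ↔ _
    rw [e.symm_apply_apply]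
  have hsp : hW'.fromSpec P' ⤳ j y := by
    suffices H : P' ⤳ hW'.primeIdealOf ⟨j y, hy⟩ by
      have := H.map hW'.fromSpec.continuous
      rwa [hW'.fromSpec_primeIdealOf] at this
    rw [← PrimeSpectrum.le_iff_specializes]
    intro g hg
    obtain ⟨g, rfl⟩ := (bijective_polyToSections hW).2 g
    by_contra hg'
    exact hP g ((hmem g).1 hg) ((isUnit_polyStalk_iff j hW hy g).2 hg')
  -- Open sets are stable under generization, so the point of affine space defined by the prime lies
  -- in Y.
  obtain ⟨z, hz⟩ : hW'.fromSpec P' ∈ Set.range j :=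
    hsp.mem_open j.isOpenEmbedding.isOpen_range ⟨y, rfl⟩
  have hzW : baseHom j z ∈ W := by
    have : j z ∈ (𝔸(n; X) ↘ X) ⁻¹ᵁ W := by
      rw [hz, ← SetLike.mem_coe, ← hW'.range_fromSpec]
      exact ⟨P', rfl⟩
    exact this
  refine ⟨z, hzW, ?_, fun g => ?_⟩
  · rw [← j.isOpenEmbedding.isInducing.specializes_iff, hz]
    exact hsp
  · rw [isUnit_polyStalk_iff j hW hzW, ← hmem]
    have : hW'.primeIdealOf ⟨j z, hzW⟩ = P' := by
      apply hW'.fromSpec.isOpenEmbedding.injective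
      rw [hW'.fromSpec_primeIdealOf]
      exact hz
    rw [this]

end AffineSpace

end AlgebraicGeometry
end

/-! ### Rational functions on Y and clearing denominators from the base -/

noncomputable section

namespace AlgebraicGeometry

/-- On an affine open subset, a point is a generization of another one as soon as every function
invertible at the latter is invertible at the former. -/
lemma IsAffineOpen.specializes_of_isUnit_imp {X : Scheme.{u}} {V : X.Opens} (hV : IsAffineOpen V)
    {x y : X} (hx : x ∈ V) (hy : y ∈ V)
    (h : ∀ s, IsUnit (X.presheaf.germ V y hy s) → IsUnit (X.presheaf.germ V x hx s)) : x ⤳ y := by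
  suffices H : hV.primeIdealOf ⟨x, hx⟩ ⤳ hV.primeIdealOf ⟨y, hy⟩ by
    have := H.map hV.fromSpec.continuous
    rwa [hV.fromSpec_primeIdealOf, hV.fromSpec_primeIdealOf] at this
  rw [← PrimeSpectrum.le_iff_specializes]
  intro g hg
  by_contra hg'
  exact (hV.isUnit_germ_iff ⟨x, hx⟩ g).1 (h g ((hV.isUnit_germ_iff ⟨y, hy⟩ g).2 hg')) hg

/-- A point of an affine open subset at which all nonzero functions are invertible is the generic
point. -/
lemma IsAffineOpen.eq_genericPoint {X : Scheme.{u}} [IsIntegral X] {V : X.Opens}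
    (hV : IsAffineOpen V) {x : X} (hx : x ∈ V)
    (h : ∀ s ≠ 0, IsUnit (X.presheaf.germ V x hx s)) : x = genericPoint X := by
  refine Specializes.antisymm ?_ (genericPoint_specializes x) |>.eq
  refine hV.specializes_of_isUnit_imp hx
    ((genericPoint_specializes x).mem_open V.2 hx) fun s hs => h s ?_
  rintro rfl
  rw [map_zero] at hs
  exact not_isUnit_zero hs

namespace AffineSpace

variable {n : Type u} {X Y : Scheme.{u}} (j : Y ⟶ 𝔸(n; X))

lemma stalkSpecializes_polyStalk {W : X.Opens} {y z : Y} (h : z ⤳ y) (hy : baseHom j y ∈ W)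
    (hz : baseHom j z ∈ W) (g : MvPolynomial n Γ(X, W)) :
    Y.presheaf.stalkSpecializes h (polyStalk j hy g) = polyStalk j hz g := by
  refine RingHom.congr_fun (f := (Y.presheaf.stalkSpecializes h).hom.comp (polyStalk j hy)) ?_ g
  apply MvPolynomial.ringHom_ext
  · intro r
    simp only [polyStalk, stalkPolyStalk, RingHom.comp_apply, MvPolynomial.map_C,
      MvPolynomial.coe_eval₂Hom, MvPolynomial.eval₂_C]
    have h1 := Scheme.Hom.germ_stalkMap_apply (baseHom j) W y hy r
    have h2 := Scheme.Hom.germ_stalkMap_apply (baseHom j) W z hz r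
    refine (congrArg _ h1).trans (Eq.trans ?_ h2.symm)
    exact TopCat.Presheaf.germ_stalkSpecializes_apply Y.presheaf _ _ _
  · intro i
    simp only [polyStalk, stalkPolyStalk, RingHom.comp_apply, MvPolynomial.map_X,
      MvPolynomial.coe_eval₂Hom, MvPolynomial.eval₂_X, coordStalk]
    exact TopCat.Presheaf.germ_stalkSpecializes_apply Y.presheaf _ _ _

/-- A polynomial none of whose coefficients is invertible at the image of `y` is not invertible
at `y`. -/
lemma not_isUnit_polyStalk {W : X.Opens} {y : Y} (hy : baseHom j y ∈ W)
    (g : MvPolynomial n Γ(X, W))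
    (hg : ∀ m, ¬ IsUnit (X.presheaf.germ W (baseHom j y) hy (g.coeff m))) :
    ¬ IsUnit (polyStalk j hy g) := by
  suffices H : polyStalk j hy g ∈ IsLocalRing.maximalIdeal (Y.presheaf.stalk y) from H
  rw [polyStalk, RingHom.comp_apply, stalkPolyStalk, MvPolynomial.coe_eval₂Hom,
    MvPolynomial.eval₂_eq]
  refine sum_mem fun m _ => Ideal.mul_mem_right _ _ ?_
  rw [MvPolynomial.coeff_map, IsLocalRing.mem_maximalIdeal, mem_nonunits_iff]
  intro hu
  exact hg m ((isUnit_map_iff ((baseHom j).stalkMap y).hom _).1 hu)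

variable [IsOpenImmersion j] [IsIntegral X] [IsIntegral Y]

/-- The projection is open, so its image contains the generic point of X; the generic point of Y
specializes to any preimage of it. -/
lemma baseHom_genericPoint : baseHom j (genericPoint Y) = genericPoint X := by
  have hopen : IsOpen (Set.range (baseHom j)) := by
    have h : IsOpenMap (baseHom j) := by
      have := (isOpenMap_over (n := n) (S := X)).comp j.isOpenEmbedding.isOpenMap
      rwa [← TopCat.coe_comp, ← Scheme.Hom.comp_base] at this
    exact h.isOpen_range
  obtain ⟨y, hy⟩ : genericPoint X ∈ Set.range (baseHom j) :=
    ((genericPoint_spec X).mem_open_set_iff hopen).2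
      ⟨baseHom j (genericPoint Y), trivial, ⟨_, rfl⟩⟩
  refine Specializes.antisymm ?_ (genericPoint_specializes _) |>.eq
  rw [← hy]
  exact (genericPoint_specializes y).map (baseHom j).continuous

lemma specializes_genericPoint (x : X) : baseHom j (genericPoint Y) ⤳ x := by
  rw [baseHom_genericPoint]
  exact genericPoint_specializes x

/-- Polynomials over the function field of the base as rational functions. -/
def polyFunctionField : MvPolynomial n X.functionField →+* Y.functionField :=
  -- The generic point of Y lies over that of X only up to a propositional equality, so coefficients
  -- are transported by a specialization map of stalks.
  (stalkPolyStalk j (genericPoint Y)).comp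
    (MvPolynomial.map (X.presheaf.stalkSpecializes
      (specializes_genericPoint j (genericPoint X))).hom)

lemma algebraMap_stalkPolyStalk (y : Y) (a : MvPolynomial n (X.presheaf.stalk (baseHom j y))) :
    algebraMap _ Y.functionField (stalkPolyStalk j y a) =
      polyFunctionField j (MvPolynomial.map (algebraMap _ X.functionField) a) := by
  refine RingHom.congr_fun (f := (algebraMap _ Y.functionField).comp (stalkPolyStalk j y))
    (g := (polyFunctionField j).comp (MvPolynomial.map (algebraMap _ X.functionField))) ?_ a
  apply MvPolynomial.ringHom_ext
  · intro r
    simp only [polyFunctionField, stalkPolyStalk, RingHom.comp_apply, MvPolynomial.map_C,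
      MvPolynomial.coe_eval₂Hom, MvPolynomial.eval₂_C]
    refine (Scheme.Hom.stalkSpecializes_stalkMap_apply (baseHom j) _ _
      (genericPoint_specializes y) r).symm.trans (congrArg _ ?_)
    exact (TopCat.Presheaf.stalkSpecializes_comp_apply X.presheaf _ _ r).symm
  · intro i
    simp only [polyFunctionField, stalkPolyStalk, RingHom.comp_apply, MvPolynomial.map_X,
      MvPolynomial.coe_eval₂Hom, MvPolynomial.eval₂_X, coordStalk]
    exact TopCat.Presheaf.germ_stalkSpecializes_apply Y.presheaf _ _ _

/-- Polynomials over the sections on an open subset of the base as rational functions. -/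
def polyRat (W : X.Opens) [Nonempty W] : MvPolynomial n Γ(X, W) →+* Y.functionField :=
  (polyFunctionField j).comp (MvPolynomial.map (X.germToFunctionField W).hom)

lemma algebraMap_polyStalk {W : X.Opens} [Nonempty W] {y : Y} (hy : baseHom j y ∈ W)
    (g : MvPolynomial n Γ(X, W)) :
    algebraMap _ Y.functionField (polyStalk j hy g) = polyRat j W g := by
  rw [polyStalk, RingHom.comp_apply, algebraMap_stalkPolyStalk, polyRat, RingHom.comp_apply,
    MvPolynomial.map_map]
  congr 3
  exact RingHom.ext fun r => Scheme.algebraMap_germ_eq_germToFunctionField X hy r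

lemma polyRat_injective {W : X.Opens} [Nonempty W] (hW : IsAffineOpen W) :
    Function.Injective (polyRat j W) := by
  have hη : baseHom j (genericPoint Y) ∈ W := by
    rw [baseHom_genericPoint]
    exact ((genericPoint_spec X).mem_open_set_iff W.2).2 (by simpa using ‹Nonempty W›)
  intro a b hab
  rw [← algebraMap_polyStalk j hη, ← algebraMap_polyStalk j hη] at hab
  have h1 : polyStalk j hη a = polyStalk j hη b :=
    Scheme.algebraMap_stalk_injective _ hab
  rw [polyStalk_eq, polyStalk_eq] at h1
  exact (bijective_polyToSections hW).1 (germ_injective_of_isIntegral _ (j (genericPoint Y)) hη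
    ((ConcreteCategory.bijective_of_isIso (j.stalkMap (genericPoint Y))).1 h1))

lemma exists_C_mul_eq_map {R K σ : Type*} [CommRing R] [IsDomain R] [Field K] [Algebra R K]
    [IsFractionRing R K] (f : MvPolynomial σ K) : ∃ (c : R) (g : MvPolynomial σ R), c ≠ 0 ∧
      MvPolynomial.C (algebraMap R K c) * f = MvPolynomial.map (algebraMap R K) g := by
  obtain ⟨b, hb⟩ := IsLocalization.exist_integer_multiples_of_finset (nonZeroDivisors R) f.coeffs
  have : MvPolynomial.C (algebraMap R K b) * f ∈
      Set.range (MvPolynomial.map (σ := σ) (algebraMap R K)) := by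
    rw [MvPolynomial.mem_range_map_iff_coeffs_subset]
    intro x hx
    obtain ⟨m, hm, rfl⟩ := MvPolynomial.mem_coeffs_iff.1 hx
    rw [MvPolynomial.coeff_C_mul]
    have hm' : f.coeff m ≠ 0 := fun h => by
      rw [MvPolynomial.mem_support_iff, MvPolynomial.coeff_C_mul, h, mul_zero] at hm
      exact hm rfl
    obtain ⟨r, hr⟩ := hb _ (MvPolynomial.coeff_mem_coeffs m hm')
    exact ⟨r, by rw [hr, Algebra.smul_def]⟩
  obtain ⟨g, hg⟩ := this
  exact ⟨b, g, nonZeroDivisors.ne_zero b.2, hg.symm⟩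

/-- A rational function that is regular at all generizations of `y` on the generic fibre can be
made regular at `y` by multiplying it with a function on the base. -/
lemma exists_C_mul_polyRat_eq {W : X.Opens} [Nonempty W] (hW : IsAffineOpen W) {y : Y}
    (hy : baseHom j y ∈ W) (f : Y.functionField)
    (hf : ∀ z, z ⤳ y → baseHom j z = genericPoint X →
      ∃ t, f = algebraMap (Y.presheaf.stalk z) Y.functionField t) :
    ∃ (a s : MvPolynomial n Γ(X, W)) (c : Γ(X, W)), c ≠ 0 ∧ IsUnit (polyStalk j hy s) ∧
      f * polyRat j W (MvPolynomial.C c * s) = polyRat j W a := by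
  -- J is the ideal of denominators of f, and S below is the set of allowed denominators. If J
  -- missed S, a prime containing J and missing S would define a generization of y on the generic
  -- fibre, where regularity of f provides a denominator outside that prime.
  let J : Ideal (MvPolynomial n Γ(X, W)) :=
    { carrier := {b | ∃ a, f * polyRat j W b = polyRat j W a}
      zero_mem' := ⟨0, by rw [map_zero, mul_zero]⟩
      add_mem' := by
        rintro b b' ⟨a, h⟩ ⟨a', h'⟩
        exact ⟨a + a', by rw [map_add, map_add, mul_add, h, h']⟩
      smul_mem' := by
        rintro r b ⟨a, h⟩
        exact ⟨r * a, by rw [smul_eq_mul, map_mul, map_mul, mul_left_comm, h]⟩ }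
  let S : Submonoid (MvPolynomial n Γ(X, W)) :=
    { carrier := {b | ∃ c s, c ≠ 0 ∧ IsUnit (polyStalk j hy s) ∧ b = MvPolynomial.C c * s}
      one_mem' := ⟨1, 1, one_ne_zero, by rw [map_one]; exact isUnit_one, by simp⟩
      mul_mem' := by
        rintro _ _ ⟨c, s, hc, hs, rfl⟩ ⟨c', s', hc', hs', rfl⟩
        refine ⟨c * c', s * s', mul_ne_zero hc hc', by rw [map_mul]; exact hs.mul hs', ?_⟩
        rw [MvPolynomial.C_mul]
        ring }
  by_cases hdis : Disjoint (J : Set (MvPolynomial n Γ(X, W))) S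
  · exfalso
    obtain ⟨P, hP, hJP, hPS⟩ := Ideal.exists_le_prime_disjoint J S hdis
    rw [Set.disjoint_left] at hPS
    obtain ⟨z, hz, hzy, hzP⟩ := exists_specializes_of_isPrime j hW hy P fun g hg hu =>
      hPS hg ⟨1, g, one_ne_zero, hu, by simp⟩
    have hgen : baseHom j z = genericPoint X := by
      refine hW.eq_genericPoint hz fun c hc => ?_
      have h1 : IsUnit (polyStalk j hz (MvPolynomial.C c)) :=
        (hzP _).2 fun hcP => hPS hcP ⟨c, 1, hc, by rw [map_one]; exact isUnit_one, by simp⟩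
      rw [polyStalk, RingHom.comp_apply, MvPolynomial.map_C, stalkPolyStalk,
        MvPolynomial.coe_eval₂Hom, MvPolynomial.eval₂_C] at h1
      exact (isUnit_map_iff ((baseHom j).stalkMap z).hom _).1 h1
    obtain ⟨t, rfl⟩ := hf z hzy hgen
    obtain ⟨a, s, hs, has⟩ := exists_mul_polyStalk_eq j hW hz t
    refine (hzP s).1 hs (hJP ⟨a, ?_⟩)
    rw [← algebraMap_polyStalk j hz, ← algebraMap_polyStalk j hz, ← map_mul, has]
  · obtain ⟨_, ⟨a, ha⟩, c, s, hc, hs, rfl⟩ := Set.not_disjoint_iff.1 hdis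
    exact ⟨a, s, c, hc, hs, ha⟩

end AffineSpace

end AlgebraicGeometry
end

/-! ### Two regularity criteria: along a fibre and along a section -/

noncomputable section

namespace AlgebraicGeometry

namespace Scheme

variable {X : Scheme.{u}} [IsIntegral X]

lemma exists_eq_algebraMap_of_mem_unitsAt {x : X} {f : X.functionFieldˣ} (hf : f ∈ X.unitsAt x) :
    ∃ t, (f : X.functionField) = algebraMap (X.presheaf.stalk x) X.functionField t := by
  obtain ⟨a, rfl⟩ := hf
  exact ⟨a, rfl⟩

lemma mem_unitsAt_of_eq_algebraMap {x : X} {f : X.functionFieldˣ}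
    (hf : ∃ t, (f : X.functionField) = algebraMap (X.presheaf.stalk x) X.functionField t)
    (hf' : ∃ t, ((f⁻¹ : X.functionFieldˣ) : X.functionField) =
      algebraMap (X.presheaf.stalk x) X.functionField t) : f ∈ X.unitsAt x := by
  obtain ⟨t, ht⟩ := hf
  obtain ⟨t', ht'⟩ := hf'
  refine mem_unitsAt_of_isUnit (IsUnit.of_mul_eq_one t' (algebraMap_stalk_injective x ?_)) ht
  rw [map_mul, ← ht, ← ht', map_one, Units.mul_inv]

/-- Meant for φ = `β ≫ baseHom j`, which is the identity only propositionally; a variable φ allows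
the equality to be substituted. -/
lemma germ_app_of_eq_id {X : Scheme.{u}} (φ : X ⟶ X) (hφ : φ = 𝟙 X) (W : X.Opens) (p : X) (hp : p ∈ W)
    (hp' : p ∈ φ ⁻¹ᵁ W) (r : Γ(X, W)) :
    X.presheaf.germ (φ ⁻¹ᵁ W) p hp' (φ.app W r) = X.presheaf.germ W p hp r := by
  subst hφ
  rfl

end Scheme

namespace AffineSpace

open Scheme

variable {n : Type u} {X Y : Scheme.{u}} (j : Y ⟶ 𝔸(n; X)) [IsOpenImmersion j]
  [IsIntegral X] [IsIntegral Y]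

lemma exists_eq_algebraMap_of_mul {y : Y} {s t : Y.presheaf.stalk y} (hs : IsUnit s)
    {f : Y.functionField}
    (h : f * algebraMap _ Y.functionField s = algebraMap _ Y.functionField t) :
    ∃ t, f = algebraMap (Y.presheaf.stalk y) Y.functionField t := by
  obtain ⟨s, rfl⟩ := hs
  refine ⟨t * ↑s⁻¹, ?_⟩
  rw [map_mul, ← h, mul_assoc, ← map_mul, Units.mul_inv, map_one, mul_one]

/-- A rational function which is regular at the generizations of `y` on the generic fibre and at
the generic point of the fibre through `y` is regular at `y`. -/
lemma exists_eq_algebraMap_of_fibre [Finite n] {W : X.Opens} [Nonempty W] (hW : IsAffineOpen W)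
    {y : Y} (hy : baseHom j y ∈ W) (f : Y.functionField)
    (hf : ∀ z, z ⤳ y → baseHom j z = genericPoint X →
      ∃ t, f = algebraMap (Y.presheaf.stalk z) Y.functionField t)
    {g h : MvPolynomial n Γ(X, W)} {m : n →₀ ℕ}
    (hm : IsUnit (X.presheaf.germ W (baseHom j y) hy (h.coeff m)))
    (hgh : f * polyRat j W h = polyRat j W g) :
    ∃ t, f = algebraMap (Y.presheaf.stalk y) Y.functionField t := by
  obtain ⟨a, s, c, hc, hs, hacs⟩ := exists_C_mul_polyRat_eq j hW hy f hf
  -- Two expressions of f are compared: a/(cs), with s invertible at y, and g/h, with a coefficient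
  -- of h invertible at the image of y. The Gauss lemma cancels h, so c divides a over the local
  -- ring of that image, and f = (a/c)/s.
  have h1 : a * h = MvPolynomial.C c * (s * g) := by
    apply polyRat_injective j hW
    rw [map_mul, map_mul, map_mul, ← hacs, ← hgh, map_mul]
    ring
  let G := MvPolynomial.map (σ := n) (X.presheaf.germ W (baseHom j y) hy).hom
  have hdvd : MvPolynomial.C (X.presheaf.germ W (baseHom j y) hy c) ∣ G a * G h := by
    rw [← map_mul, h1, map_mul, MvPolynomial.map_C]
    exact dvd_mul_right _ _
  obtain ⟨a', ha'⟩ := MvPolynomial.C_dvd_of_C_dvd_mul hdvd (m₀ := m)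
    (by rw [MvPolynomial.coeff_map]; exact hm)
  refine exists_eq_algebraMap_of_mul hs (t := stalkPolyStalk j y a') ?_
  have hcne : polyRat j W (MvPolynomial.C c) ≠ 0 := by
    rw [map_ne_zero_iff _ (polyRat_injective j hW)]
    exact (map_ne_zero_iff _ (MvPolynomial.C_injective n _)).2 hc
  have h2 : polyRat j W a = polyRat j W (MvPolynomial.C c) *
      algebraMap _ Y.functionField (stalkPolyStalk j y a') := by
    rw [← algebraMap_polyStalk j hy, ← algebraMap_polyStalk j hy, ← map_mul]
    congr 1
    change stalkPolyStalk j y (G a) = stalkPolyStalk j y (G (MvPolynomial.C c)) * _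
    rw [ha', map_mul, MvPolynomial.map_C]
  apply mul_left_cancel₀ hcne
  rw [← h2, ← hacs, algebraMap_polyStalk, map_mul]
  ring

variable (β : X ⟶ Y)

/-- Evaluation of polynomials along a section. -/
def sectionEval {W : X.Opens} {p : X} (hy : baseHom j (β p) ∈ W) :
    MvPolynomial n Γ(X, W) →+* X.presheaf.stalk p :=
  (β.stalkMap p).hom.comp (polyStalk j hy)

/-- Constants are preserved because β is a section, so restricting a polynomial to the section is
evaluation at the coordinates of the section. -/
lemma algebraMap_sectionEval (hβ : β ≫ baseHom j = 𝟙 X) {W : X.Opens} [Nonempty W] {p : X}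
    (hy : baseHom j (β p) ∈ W) (g : MvPolynomial n Γ(X, W)) :
    algebraMap _ X.functionField (sectionEval j β hy g) =
      MvPolynomial.eval (fun i => algebraMap _ X.functionField
        (β.stalkMap p (coordStalk j (β p) i)))
        (MvPolynomial.map (X.germToFunctionField W).hom g) := by
  refine RingHom.congr_fun (f := (algebraMap _ X.functionField).comp (sectionEval j β hy))
    (g := (MvPolynomial.eval (fun i => algebraMap _ X.functionField
        (β.stalkMap p (coordStalk j (β p) i)))).comp
        (MvPolynomial.map (X.germToFunctionField W).hom)) ?_ g
  have hpW : p ∈ W := by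
    have : (β ≫ baseHom j) p ∈ W := hy
    rwa [hβ] at this
  apply MvPolynomial.ringHom_ext
  · intro r
    simp only [sectionEval, polyStalk, stalkPolyStalk, RingHom.comp_apply, MvPolynomial.map_C,
      MvPolynomial.coe_eval₂Hom, MvPolynomial.eval₂_C, MvPolynomial.eval_C]
    have h1 := Scheme.Hom.germ_stalkMap_apply (baseHom j) W (β p) hy r
    have h2 := Scheme.Hom.germ_stalkMap_apply β (baseHom j ⁻¹ᵁ W) p hy ((baseHom j).app W r)
    have h3 := germ_app_of_eq_id (β ≫ baseHom j) hβ W p hpW hy r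
    have h4 : β.stalkMap p ((baseHom j).stalkMap (β p)
        (X.presheaf.germ W (baseHom j (β p)) hy r)) = X.presheaf.germ W p hpW r := by
      refine ((congrArg _ h1).trans h2).trans (Eq.trans ?_ h3)
      rw [Scheme.Hom.comp_app β]
      rfl
    exact (congrArg _ h4).trans (Scheme.algebraMap_germ_eq_germToFunctionField X hpW r)
  · intro i
    simp only [sectionEval, polyStalk, stalkPolyStalk, RingHom.comp_apply, MvPolynomial.map_X,
      MvPolynomial.coe_eval₂Hom, MvPolynomial.eval₂_X, MvPolynomial.eval_X]

lemma algebraMap_sectionEval_of_specializes {W : X.Opens} {p x : X} (h : x ⤳ p)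
    (hp : baseHom j (β p) ∈ W) (hx : baseHom j (β x) ∈ W) (g : MvPolynomial n Γ(X, W)) :
    algebraMap _ X.functionField (sectionEval j β hx g) =
      algebraMap _ X.functionField (sectionEval j β hp g) := by
  have h1 := Scheme.Hom.stalkSpecializes_stalkMap_apply β _ _ h (polyStalk j hp g)
  rw [stalkSpecializes_polyStalk j (h.map β.continuous) hp hx] at h1
  exact (congrArg _ h1).trans (algebraMap_stalkSpecializes h _)

lemma algebraMap_stalkMap_mul_sectionEval {W : X.Opens} [Nonempty W] {x : X}
    (hx : baseHom j (β x) ∈ W) (t : Y.presheaf.stalk (β x)) {a b : MvPolynomial n Γ(X, W)}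
    (h : algebraMap _ Y.functionField t * polyRat j W b = polyRat j W a) :
    algebraMap _ X.functionField (β.stalkMap x t) *
      algebraMap _ X.functionField (sectionEval j β hx b) =
      algebraMap _ X.functionField (sectionEval j β hx a) := by
  rw [← map_mul]
  congr 1
  refine (map_mul (β.stalkMap x).hom _ _).symm.trans (congrArg (β.stalkMap x) ?_)
  apply algebraMap_stalk_injective
  rw [map_mul, algebraMap_polyStalk, algebraMap_polyStalk, h]

lemma pullbackUnits_mul_sectionEval {W : X.Opens} [Nonempty W] {p : X}
    (hy : baseHom j (β p) ∈ W) (f : Y.unitsAt (β (genericPoint X)))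
    {a b : MvPolynomial n Γ(X, W)}
    (h : (f.1 : Y.functionField) * polyRat j W b = polyRat j W a) :
    (pullbackUnits β f : X.functionField) * algebraMap _ X.functionField (sectionEval j β hy b) =
      algebraMap _ X.functionField (sectionEval j β hy a) := by
  obtain ⟨t, ht⟩ := exists_eq_algebraMap_of_mem_unitsAt f.2
  have hη : baseHom j (β (genericPoint X)) ∈ W :=
    ((genericPoint_specializes_map β p).map (baseHom j).continuous).mem_open W.2 hy
  rw [coe_pullbackUnits β (genericPoint X) t f ht,
    ← algebraMap_sectionEval_of_specializes j β (genericPoint_specializes p) hy hη b,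
    ← algebraMap_sectionEval_of_specializes j β (genericPoint_specializes p) hy hη a]
  exact algebraMap_stalkMap_mul_sectionEval j β hη t (by rw [← ht]; exact h)

lemma exists_algebraMap_eq_polyFunctionField {y : Y} {p : X} (hp : p = baseHom j y)
    (a : MvPolynomial n (X.presheaf.stalk p)) :
    ∃ t, polyFunctionField j (MvPolynomial.map (algebraMap _ X.functionField) a) =
      algebraMap (Y.presheaf.stalk y) Y.functionField t := by
  subst hp
  exact ⟨_, (algebraMap_stalkPolyStalk j y a).symm⟩

/-- A rational function regular on the generic fibre, with regular inverse on the generic fibre,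
is regular at a point of a section if its restriction to the section is invertible. -/
lemma exists_eq_algebraMap_of_section (hβ : β ≫ baseHom j = 𝟙 X) (p : X)
    [IsIntegrallyClosed (X.presheaf.stalk p)]
    (f : Y.functionFieldˣ) (hfη : f ∈ Y.unitsAt (β (genericPoint X)))
    (hf : ∀ z, z ⤳ β p → baseHom j z = genericPoint X → f ∈ Y.unitsAt z)
    (hp : pullbackUnits β ⟨f, hfη⟩ ∈ X.unitsAt p) :
    ∃ t, (f : Y.functionField) = algebraMap (Y.presheaf.stalk (β p)) Y.functionField t := by
  have hid : baseHom j (β p) = p := by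
    change (β ≫ baseHom j) p = p
    rw [hβ]; rfl
  obtain ⟨_, ⟨W, hW, rfl⟩, hpW, -⟩ := X.isBasis_affineOpens.exists_subset_of_mem_open
    (Set.mem_univ p) isOpen_univ
  have hy : baseHom j (β p) ∈ W := by rw [hid]; exact hpW
  have : Nonempty W := ⟨⟨p, hpW⟩⟩
  have := functionField_isFractionRing_of_isAffineOpen X W hW
  obtain ⟨a, s, c, hc, hs, hacs⟩ := exists_C_mul_polyRat_eq j hW hy f
    fun z hz hzη => exists_eq_algebraMap_of_mem_unitsAt (hf z hz hzη)
  obtain ⟨b, t, e, he, ht, hbet⟩ := exists_C_mul_polyRat_eq j hW hy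
    (f⁻¹ : Y.functionFieldˣ)
    fun z hz hzη => exists_eq_algebraMap_of_mem_unitsAt (inv_mem (hf z hz hzη))
  -- From f = a/(cs) and f⁻¹ = b/(et), the polynomials a/c and b/e over K(X) have product st, which
  -- is defined over the local ring at p.
  have hab : a * b = (MvPolynomial.C c * s) * (MvPolynomial.C e * t) := by
    apply polyRat_injective j hW
    rw [map_mul, ← hacs, ← hbet, mul_mul_mul_comm, Units.mul_inv, one_mul, ← map_mul]
  set ρ : Γ(X, W) →+* X.functionField := (X.germToFunctionField W).hom with hρ
  have hρinj : Function.Injective ρ := X.germToFunctionField_injective W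
  have hρc : ρ c ≠ 0 := (map_ne_zero_iff _ hρinj).2 hc
  have hρe : ρ e ≠ 0 := (map_ne_zero_iff _ hρinj).2 he
  obtain ⟨v, hv⟩ := hp
  -- the value at the section of the polynomial `a / c`
  have hval : ∀ {c : Γ(X, W)} {a s : MvPolynomial n Γ(X, W)} (_ : ρ c ≠ 0)
      (_ : IsUnit (polyStalk j hy s)) (g : Y.unitsAt (β (genericPoint X)))
      (_ : (g.1 : Y.functionField) * polyRat j W (MvPolynomial.C c * s) = polyRat j W a)
      (v : (X.presheaf.stalk p)ˣ)
      (_ : (pullbackUnits β g : X.functionField) = algebraMap _ _ (v : X.presheaf.stalk p)),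
      ∃ w : (X.presheaf.stalk p)ˣ, MvPolynomial.eval
        (fun i => algebraMap _ X.functionField (β.stalkMap p (coordStalk j (β p) i)))
        (MvPolynomial.C (ρ c)⁻¹ * MvPolynomial.map ρ a) =
          algebraMap _ X.functionField (w : X.presheaf.stalk p) := by
    intro c a s hc hs g hg v hv
    obtain ⟨w, hw⟩ := hs.map (β.stalkMap p).hom
    refine ⟨v * w, ?_⟩
    have h1 := pullbackUnits_mul_sectionEval j β hy g hg
    rw [map_mul, map_mul, hv, algebraMap_sectionEval j β hβ hy (MvPolynomial.C c),
      MvPolynomial.map_C, MvPolynomial.eval_C, algebraMap_sectionEval j β hβ hy a] at h1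
    rw [map_mul, MvPolynomial.eval_C, ← h1, Units.val_mul, map_mul, hw]
    change (ρ c)⁻¹ * (_ * (ρ c * algebraMap _ X.functionField (β.stalkMap p (polyStalk j hy s))))
      = _ * algebraMap _ X.functionField (β.stalkMap p (polyStalk j hy s))
    field_simp
  have hprod : (MvPolynomial.C (ρ c)⁻¹ * MvPolynomial.map ρ a) *
      (MvPolynomial.C (ρ e)⁻¹ * MvPolynomial.map ρ b) =
      MvPolynomial.map (algebraMap (X.presheaf.stalk p) X.functionField)
        (MvPolynomial.map (X.presheaf.germ W p hpW).hom (s * t)) := by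
    have h1 : (algebraMap (X.presheaf.stalk p) X.functionField).comp
        (X.presheaf.germ W p hpW).hom = ρ :=
      RingHom.ext fun r => Scheme.algebraMap_germ_eq_germToFunctionField X hpW r
    rw [MvPolynomial.map_map, h1, mul_mul_mul_comm, ← map_mul (MvPolynomial.map ρ), hab]
    simp only [map_mul, MvPolynomial.map_C]
    have h2 : (MvPolynomial.C (ρ c)⁻¹ : MvPolynomial n X.functionField) *
        MvPolynomial.C (ρ c) = 1 := by
      rw [← MvPolynomial.C_mul, inv_mul_cancel₀ hρc, MvPolynomial.C_1]
    have h3 : (MvPolynomial.C (ρ e)⁻¹ : MvPolynomial n X.functionField) *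
        MvPolynomial.C (ρ e) = 1 := by
      rw [← MvPolynomial.C_mul, inv_mul_cancel₀ hρe, MvPolynomial.C_1]
    linear_combination (MvPolynomial.map ρ s * MvPolynomial.map ρ t *
      MvPolynomial.C (ρ e)⁻¹ * MvPolynomial.C (ρ e)) * h2 +
      (MvPolynomial.map ρ s * MvPolynomial.map ρ t) * h3
  -- Normality enters here. The values of a/c and b/e on the section are units because f and its
  -- inverse restrict to units there, as do s and t.
  obtain ⟨a', ha'⟩ := MvPolynomial.mem_range_map_of_mul_eq_map hprod
    (fun i => β.stalkMap p (coordStalk j (β p) i))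
    (hval hρc hs ⟨f, hfη⟩ hacs v (congrArg Units.val hv.symm))
    (hval hρe ht (⟨f, hfη⟩⁻¹) hbet v⁻¹ (by
      rw [map_inv, ← hv, ← map_inv]
      rfl))
  obtain ⟨t', ht'⟩ := exists_algebraMap_eq_polyFunctionField j hid.symm a'
  refine exists_eq_algebraMap_of_mul hs (t := t') ?_
  rw [← ht', ha', algebraMap_polyStalk]
  have hcne : polyRat j W (MvPolynomial.C c) ≠ 0 := by
    rw [map_ne_zero_iff _ (polyRat_injective j hW)]
    exact (map_ne_zero_iff _ (MvPolynomial.C_injective n _)).2 hc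
  apply mul_left_cancel₀ hcne
  rw [map_mul, mul_left_comm, ← map_mul, hacs]
  rw [polyRat, RingHom.comp_apply, RingHom.comp_apply, MvPolynomial.map_C, ← mul_assoc, ← map_mul,
    ← MvPolynomial.C_mul]
  change _ = polyFunctionField j (MvPolynomial.C (ρ c * (ρ c)⁻¹)) * _
  rw [mul_inv_cancel₀ hρc, map_one, map_one, one_mul]

end AffineSpace

end AlgebraicGeometry
end

/-! ### Divisors trivial on the generic fibre -/

noncomputable section

namespace AlgebraicGeometry

namespace Scheme

lemma mem_unitsAt_genericPoint {X : Scheme.{u}} [IsIntegral X] (f : X.functionFieldˣ) :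
    f ∈ X.unitsAt (genericPoint X) :=
  mem_unitsAt_of_eq_algebraMap
    ⟨f.1, (congr($(TopCat.Presheaf.stalkSpecializes_refl X.presheaf (genericPoint X)) f.1)).symm⟩
    ⟨(f⁻¹).1,
      (congr($(TopCat.Presheaf.stalkSpecializes_refl X.presheaf (genericPoint X)) (f⁻¹).1)).symm⟩

/-- Every nonzero rational function is a unit at the generic point. Hence every divisor on X can be
pulled back along the projection without being moved. -/
lemma divisor_genericPoint {X : Scheme.{u}} [IsIntegral X] (D : X.cartierDivisors) :
    D.1 (genericPoint X) = 1 := by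
  obtain ⟨f, hf⟩ := X.divisorGerm_surjective _ (D.1 (genericPoint X))
  rw [← hf, divisorGerm_eq_one_iff]
  exact mem_unitsAt_genericPoint f

end Scheme

namespace AffineSpace

open Scheme

variable {n : Type u} {X Y : Scheme.{u}} (j : Y ⟶ 𝔸(n; X)) [IsOpenImmersion j]
  [IsIntegral X] [IsIntegral Y] (β : X ⟶ Y)

lemma mem_divisorsAvoiding_baseHom (E : X.cartierDivisors) : E ∈ divisorsAvoiding (baseHom j) := by
  change E.1 (baseHom j (genericPoint Y)) = 1
  rw [baseHom_genericPoint]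
  exact divisor_genericPoint E

lemma baseHom_section (hβ : β ≫ baseHom j = 𝟙 X) (p : X) : baseHom j (β p) = p := by
  change (β ≫ baseHom j) p = p
  rw [hβ]; rfl

/-- A divisor which is trivial on the generic fibre and whose restriction to a section is trivial
is trivial along the section. -/
lemma divisor_section_eq_one [∀ x, IsIntegrallyClosed (X.presheaf.stalk x)]
    (hβ : β ≫ baseHom j = 𝟙 X) (D : divisorsAvoiding β)
    (hgen : ∀ z, baseHom j z = genericPoint X → D.1.1 z = 1)
    (hD : pullbackDivisor β D = 1) (p : X) : D.1.1 (β p) = 1 := by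
  obtain ⟨N, hN, f, hf⟩ := D.1.2 (β p)
  have hreg : ∀ z, z ⤳ β p → baseHom j z = genericPoint X → f ∈ Y.unitsAt z := by
    intro z hz hzη
    rw [← divisorGerm_eq_one_iff, ← hf z (hz.mem_open N.2 hN)]
    exact hgen z hzη
  have hfη := mem_unitsAt_of_avoiding β D p f (hf _ hN)
  have hpull : pullbackUnits β ⟨f, hfη⟩ ∈ X.unitsAt p := by
    rw [← divisorGerm_eq_one_iff, ← pullbackDivisorGerm_eq β D p f (hf _ hN)]
    exact congr($(hD).1 p)
  rw [hf _ hN, divisorGerm_eq_one_iff]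
  refine mem_unitsAt_of_eq_algebraMap
    (exists_eq_algebraMap_of_section j β hβ p f hfη hreg hpull)
    (exists_eq_algebraMap_of_section j β hβ p f⁻¹ (inv_mem hfη)
      (fun z hz hzη => inv_mem (hreg z hz hzη)) ?_)
  have : pullbackUnits β ⟨f⁻¹, inv_mem hfη⟩ = (pullbackUnits β ⟨f, hfη⟩)⁻¹ :=
    map_inv (pullbackUnits β) ⟨f, hfη⟩
  rw [this]
  exact inv_mem hpull

/-- A divisor which is trivial on the generic fibre and along a section is trivial. -/
lemma divisor_eq_one_of_section [Finite n] (hβ : β ≫ baseHom j = 𝟙 X) (D : Y.cartierDivisors)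
    (hgen : ∀ z, baseHom j z = genericPoint X → D.1 z = 1) (hD : ∀ p, D.1 (β p) = 1) (y : Y) :
    D.1 y = 1 := by
  obtain ⟨N, hN, f, hf⟩ := D.2 y
  obtain ⟨_, ⟨W, hW, rfl⟩, hy, -⟩ := X.isBasis_affineOpens.exists_subset_of_mem_open
    (Set.mem_univ (baseHom j y)) isOpen_univ
  replace hy : baseHom j y ∈ W := hy
  have : Nonempty W := ⟨⟨_, hy⟩⟩
  have hid := baseHom_section j β hβ (baseHom j y)
  have hy' : baseHom j (β (baseHom j y)) ∈ W := by rw [hid]; exact hy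
  let κ : Γ(X, W) →+* IsLocalRing.ResidueField (X.presheaf.stalk (baseHom j y)) :=
    (IsLocalRing.residue _).comp (X.presheaf.germ W _ hy).hom
  -- The polynomials vanishing on the whole fibre through y. The ideal is prime since polynomials
  -- over the residue field form a domain, and its point z is the generic point of that fibre.
  let P : Ideal (MvPolynomial n Γ(X, W)) := RingHom.ker (MvPolynomial.map (σ := n) κ)
  have hPprime : P.IsPrime := RingHom.ker_isPrime _
  have hPmem : ∀ g ∈ P, ∀ m, ¬ IsUnit (X.presheaf.germ W (baseHom j y) hy (g.coeff m)) := by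
    intro g hg m hu
    have h1 : κ (g.coeff m) = 0 := by
      rw [← MvPolynomial.coeff_map, (RingHom.mem_ker).1 hg, MvPolynomial.coeff_zero]
    exact (hu.map (IsLocalRing.residue _)).ne_zero h1
  have hgerm : ∀ (p q : X) (_ : p = q) (hp : p ∈ W) (hq : q ∈ W) (r : Γ(X, W)),
      IsUnit (X.presheaf.germ W p hp r) → IsUnit (X.presheaf.germ W q hq r) := by
    rintro p _ rfl _ _ r h; exact h
  obtain ⟨z, hz, hzy, hzP⟩ := exists_specializes_of_isPrime j hW hy P
    fun g hg => not_isUnit_polyStalk j hy g (hPmem g hg)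
  -- The point β(π(y)) lies in the same fibre, so the same ideal P defines a generization of it.
  -- This carries triviality of D from the section to z.
  obtain ⟨z', hz', hzy', hzP'⟩ := exists_specializes_of_isPrime j hW hy' P
    fun g hg => not_isUnit_polyStalk j hy' g
      fun m hu => hPmem g hg m (hgerm _ _ hid _ _ _ hu)
  have hzz' : z ⤳ z' := specializes_of_isUnit_imp j hW hz' hz
    fun g hg => (hzP g).2 ((hzP' g).1 hg)
  have hfz : f ∈ Y.unitsAt z := by
    rw [← divisorGerm_eq_one_iff, ← hf z (hzy.mem_open N.2 hN)]
    exact divisor_eq_one_of_specializes D (hzz'.trans hzy') (hD _)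
  have hreg : ∀ w, w ⤳ y → baseHom j w = genericPoint X → f ∈ Y.unitsAt w := by
    intro w hw hwη
    rw [← divisorGerm_eq_one_iff, ← hf w (hw.mem_open N.2 hN)]
    exact hgen w hwη
  have key : ∀ f : Y.functionFieldˣ, f ∈ Y.unitsAt z →
      (∀ w, w ⤳ y → baseHom j w = genericPoint X → f ∈ Y.unitsAt w) →
      ∃ t, (f : Y.functionField) = algebraMap (Y.presheaf.stalk y) Y.functionField t := by
    intro f hfz hreg
    obtain ⟨t, ht⟩ := exists_eq_algebraMap_of_mem_unitsAt hfz
    obtain ⟨g, h, hh, hgh⟩ := exists_mul_polyStalk_eq j hW hz t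
    have hhP := (hzP h).1 hh
    -- A denominator invertible at z is not in P, so one of its coefficients is nonzero in the
    -- residue field, that is, a unit of the local ring.
    obtain ⟨m, hm⟩ : ∃ m, IsUnit (X.presheaf.germ W (baseHom j y) hy (h.coeff m)) := by
      by_contra! hcon
      refine hhP ((RingHom.mem_ker).2 ?_)
      ext m
      rw [MvPolynomial.coeff_map, MvPolynomial.coeff_zero]
      exact (IsLocalRing.residue_eq_zero_iff _).2 (hcon m)
    refine exists_eq_algebraMap_of_fibre j hW hy f
      (fun w hw hwη => exists_eq_algebraMap_of_mem_unitsAt (hreg w hw hwη)) hm (g := g) ?_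
    rw [ht, ← algebraMap_polyStalk j hz, ← algebraMap_polyStalk j hz, ← map_mul, hgh]
  rw [hf y hN, divisorGerm_eq_one_iff]
  exact mem_unitsAt_of_eq_algebraMap (key f hfz hreg)
    (key f⁻¹ (inv_mem hfz) fun w hw hwη => inv_mem (hreg w hw hwη))

lemma mem_divisorsAvoiding_section (hβ : β ≫ baseHom j = 𝟙 X) {D : Y.cartierDivisors}
    (hgen : ∀ z, baseHom j z = genericPoint X → D.1 z = 1) : D ∈ divisorsAvoiding β :=
  hgen _ (baseHom_section j β hβ _)

/-- A divisor which is trivial on the generic fibre is the pullback of its restriction to a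
section. -/
lemma pullbackDivisor_baseHom_pullbackDivisor_section [Finite n]
    [∀ x, IsIntegrallyClosed (X.presheaf.stalk x)] (hβ : β ≫ baseHom j = 𝟙 X)
    (D : Y.cartierDivisors) (hgen : ∀ z, baseHom j z = genericPoint X → D.1 z = 1) :
    pullbackDivisor (baseHom j) ⟨pullbackDivisor β
      ⟨D, mem_divisorsAvoiding_section j β hβ hgen⟩, mem_divisorsAvoiding_baseHom j _⟩ = D := by
  set E := pullbackDivisor β ⟨D, mem_divisorsAvoiding_section j β hβ hgen⟩ with hE
  set D' := pullbackDivisor (baseHom j) ⟨E, mem_divisorsAvoiding_baseHom j E⟩ with hD'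
  have hgen' : ∀ z, baseHom j z = genericPoint X → D'.1 z = 1 := by
    intro z hz
    refine pullbackDivisor_apply_eq_one (baseHom j) _ z ?_
    rw [hz]
    exact divisor_genericPoint E
  have hgen'' : ∀ z, baseHom j z = genericPoint X → (D' * D⁻¹).1 z = 1 := by
    intro z hz
    change D'.1 z * (D.1 z)⁻¹ = 1
    rw [hgen' z hz, hgen z hz, inv_one, mul_one]
  have hEavoid : E ∈ divisorsAvoiding (β ≫ baseHom j) := by
    rw [hβ]
    exact divisor_genericPoint E
  have hpull : pullbackDivisor β ⟨D', mem_divisorsAvoiding_section j β hβ hgen'⟩ = E := by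
    have h1 := pullbackDivisor_comp β (baseHom j) hEavoid
    refine h1.symm.trans ?_
    have h2 : ∀ (φ : X ⟶ X) (_ : φ = 𝟙 X) (h : E ∈ divisorsAvoiding φ),
        pullbackDivisor φ ⟨E, h⟩ = E := by
      rintro φ rfl h
      exact pullbackDivisor_id ⟨E, h⟩
    exact h2 _ hβ hEavoid
  have hone : pullbackDivisor β
      ⟨D' * D⁻¹, mem_divisorsAvoiding_section j β hβ hgen''⟩ = 1 := by
    have h1 : (⟨D' * D⁻¹, mem_divisorsAvoiding_section j β hβ hgen''⟩ : divisorsAvoiding β) =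
      ⟨D', mem_divisorsAvoiding_section j β hβ hgen'⟩ *
        (⟨D, mem_divisorsAvoiding_section j β hβ hgen⟩)⁻¹ := rfl
    rw [h1, map_mul, map_inv, hpull, ← hE, mul_inv_cancel]
  have hfinal : D' * D⁻¹ = 1 := by
    apply Subtype.ext
    funext y
    exact divisor_eq_one_of_section j β hβ _ hgen''
      (divisor_section_eq_one j β hβ ⟨_, _⟩ hgen'' hone) y
  exact mul_inv_eq_one.1 hfinal

end AffineSpace

end AlgebraicGeometry
end

/-! ### Locally principal divisors on the spectrum of a factorial ring -/

noncomputable section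

namespace UniqueFactorizationMonoid

variable {A F : Type*} [CommRing A] [Field F] [Algebra A F]

variable (F) in
/-- The units of the localization at a prime ideal, inside the fraction field. -/
def unitsAtPrime (P : Ideal A) [hP : P.IsPrime] : Subgroup Fˣ where
  carrier := {f | ∃ a b : A, a ∉ P ∧ b ∉ P ∧ (f : F) * algebraMap A F b = algebraMap A F a}
  one_mem' := ⟨1, 1, P.one_notMem, P.one_notMem, by simp⟩
  mul_mem' := by
    rintro f g ⟨a, b, ha, hb, h⟩ ⟨a', b', ha', hb', h'⟩
    refine ⟨a * a', b * b', P.primeCompl.mul_mem ha ha', P.primeCompl.mul_mem hb hb', ?_⟩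
    rw [map_mul, map_mul, ← h, ← h', Units.val_mul]
    ring
  inv_mem' := by
    rintro f ⟨a, b, ha, hb, h⟩
    refine ⟨b, a, hb, ha, ?_⟩
    rw [← h, ← mul_assoc, Units.inv_mul, one_mul]

lemma unitsAtPrime_mono {P P' : Ideal A} [P.IsPrime] [P'.IsPrime] (h : P' ≤ P) :
    unitsAtPrime F P ≤ unitsAtPrime F P' := by
  rintro f ⟨a, b, ha, hb, hab⟩
  exact ⟨a, b, fun h' => ha (h h'), fun h' => hb (h h'), hab⟩

variable (F) in
/-- The subgroup of the fraction field generated by a set and the units of the ring. -/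
def closureUnits (S : Set A) : Subgroup Fˣ :=
  Subgroup.closure {f | ∃ a : A, (IsUnit a ∨ a ∈ S) ∧ (f : F) = algebraMap A F a}

lemma closureUnits_mono {S T : Set A} (h : S ⊆ T) : closureUnits F S ≤ closureUnits F T := by
  apply Subgroup.closure_mono
  rintro f ⟨a, ha, hf⟩
  exact ⟨a, ha.imp id fun ha => h ha, hf⟩

lemma closureUnits_le_unitsAtPrime {S : Set A} {P : Ideal A} [hP : P.IsPrime]
    (h : ∀ a ∈ S, a ∉ P) : closureUnits F S ≤ unitsAtPrime F P := by
  refine (Subgroup.closure_le _).2 ?_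
  rintro f ⟨a, ha, hf⟩
  refine ⟨a, 1, ?_, P.one_notMem, by rw [map_one, mul_one, hf]⟩
  rcases ha with ha | ha
  · exact fun h' => hP.ne_top (P.eq_top_of_isUnit_mem h' ha)
  · exact h a ha

/-- A positive exponent would make p divide a numerator outside (p). The exponent of p is thus
determined by the germ at (p). -/
lemma eq_zero_of_zpow_mem_unitsAtPrime [IsFractionRing A F] {p : A} [(Ideal.span {p}).IsPrime]
    {π : Fˣ} (hπ : (π : F) = algebraMap A F p) {m : ℤ}
    (h : π ^ m ∈ unitsAtPrime F (Ideal.span {p})) : m = 0 := by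
  have key : ∀ m : ℕ, π ^ m ∈ unitsAtPrime F (Ideal.span {p}) → m = 0 := by
    rintro m ⟨a, b, ha, hb, hab⟩
    by_contra hm
    refine ha (Ideal.mem_span_singleton.2 ?_)
    have : p ^ m * b = a := IsFractionRing.injective A F (by
      rw [← hab, map_mul, map_pow, Units.val_pow_eq_pow_val, hπ])
    rw [← this]
    exact (dvd_pow_self p hm).mul_right b
  obtain ⟨m, rfl | rfl⟩ := m.eq_nat_or_neg
  · rw [zpow_natCast] at h
    exact_mod_cast key m h
  · rw [zpow_neg, zpow_natCast, inv_mem_iff] at h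
    simpa using key m h

lemma exists_eq_mul_zpow_of_mem_closureUnits {S : Set A} {p : A} {π : Fˣ}
    (hπ : (π : F) = algebraMap A F p) {f : Fˣ} (hf : f ∈ closureUnits F (insert p S)) :
    ∃ g ∈ closureUnits F S, ∃ m : ℤ, f = g * π ^ m := by
  have hle : closureUnits F (insert p S) ≤ closureUnits F S ⊔ Subgroup.zpowers π := by
    refine (Subgroup.closure_le _).2 ?_
    rintro f ⟨a, ha | ha | ha, h⟩
    · exact Subgroup.mem_sup_left (Subgroup.subset_closure ⟨a, Or.inl ha, h⟩)
    · rw [show f = π from Units.ext (h.trans (hπ.trans (by rw [ha])).symm)]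
      exact Subgroup.mem_sup_right (Subgroup.mem_zpowers π)
    · exact Subgroup.mem_sup_left (Subgroup.subset_closure ⟨a, Or.inr ha, h⟩)
  obtain ⟨g, hg, h, ⟨m, rfl⟩, rfl⟩ := Subgroup.mem_sup.1 (hle hf)
  exact ⟨g, hg, m, rfl⟩

variable [IsDomain A] [IsFractionRing A F]

lemma exists_mem_closureUnits [UniqueFactorizationMonoid A] (f : Fˣ) :
    ∃ S : Set A, S.Finite ∧ (∀ p ∈ S, Prime p) ∧ f ∈ closureUnits F S := by
  have key : ∀ a : A, a ≠ 0 → ∃ S : Set A, S.Finite ∧ (∀ p ∈ S, Prime p) ∧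
      ∀ f : Fˣ, (f : F) = algebraMap A F a → f ∈ closureUnits F S := by
    intro a ha
    induction a using UniqueFactorizationMonoid.induction_on_prime with
    | h₁ => exact absurd rfl ha
    | h₂ a hu =>
      exact ⟨∅, Set.finite_empty, by simp, fun f hf =>
        Subgroup.subset_closure ⟨a, Or.inl hu, hf⟩⟩
    | h₃ a p ha' hp ih =>
      obtain ⟨S, hS, hSp, h⟩ := ih ha'
      refine ⟨insert p S, hS.insert p, ?_, ?_⟩
      · rintro q (rfl | hq)
        exacts [hp, hSp q hq]
      · intro f hf
        have hp0 : algebraMap A F p ≠ 0 :=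
          (map_ne_zero_iff _ (IsFractionRing.injective A F)).2 hp.ne_zero
        have ha0 : algebraMap A F a ≠ 0 :=
          (map_ne_zero_iff _ (IsFractionRing.injective A F)).2 ha'
        have : f = Units.mk0 _ hp0 * Units.mk0 _ ha0 := Units.ext (by simp [hf])
        rw [this]
        exact mul_mem (Subgroup.subset_closure ⟨p, Or.inr (Set.mem_insert _ _), rfl⟩)
          (closureUnits_mono (Set.subset_insert _ _) (h _ rfl))
  obtain ⟨a, b, hb, hab⟩ := IsFractionRing.div_surjective (A := A) (f : F)
  have hb0 : algebraMap A F b ≠ 0 :=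
    (map_ne_zero_iff _ (IsFractionRing.injective A F)).2 (nonZeroDivisors.ne_zero hb)
  have ha0 : algebraMap A F a ≠ 0 := fun h => f.ne_zero (by rw [← hab, h, zero_div])
  obtain ⟨S, hS, hSp, h⟩ := key a fun h => ha0 (by rw [h, map_zero])
  obtain ⟨T, hT, hTp, h'⟩ := key b (nonZeroDivisors.ne_zero hb)
  refine ⟨S ∪ T, hS.union hT, ?_, ?_⟩
  · rintro p (hp | hp)
    exacts [hSp p hp, hTp p hp]
  · have : f = Units.mk0 _ ha0 / Units.mk0 _ hb0 := Units.ext (by simp [← hab])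
    rw [this]
    exact div_mem (closureUnits_mono Set.subset_union_left (h _ rfl))
      (closureUnits_mono Set.subset_union_right (h' _ rfl))

lemma exists_subset_closureUnits [UniqueFactorizationMonoid A] {T : Set Fˣ} (hT : T.Finite) :
    ∃ S : Set A, S.Finite ∧ (∀ p ∈ S, Prime p) ∧ T ⊆ closureUnits F S := by
  choose S hS hSp h using exists_mem_closureUnits (A := A) (F := F)
  refine ⟨⋃ f ∈ T, S f, hT.biUnion fun f _ => hS f, ?_, ?_⟩
  · intro p hp
    simp only [Set.mem_iUnion] at hp
    obtain ⟨f, -, hf⟩ := hp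
    exact hSp f p hf
  · intro f hf
    exact closureUnits_mono (Set.subset_biUnion_of_mem (u := S) hf) (h f)

/-- On a subset of the spectrum of a factorial ring that is stable under generization, a locally
principal divisor with finitely many local equations is principal. -/
theorem exists_div_mem_unitsAtPrime [UniqueFactorizationMonoid A] {ι : Type*} (Q : ι → Ideal A)
    [hQp : ∀ i, (Q i).IsPrime]
    (hQ : ∀ i (P : Ideal A), P.IsPrime → P ≤ Q i → ∃ i', Q i' = P)
    (f : ι → Fˣ) (hfin : (Set.range f).Finite)
    (hf : ∀ i i', Q i' ≤ Q i → f i / f i' ∈ unitsAtPrime F (Q i')) :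
    ∃ h : Fˣ, ∀ i, f i / h ∈ unitsAtPrime F (Q i) := by
  obtain ⟨S, hS, hSp, hfS⟩ := exists_subset_closureUnits (A := A) hfin
  replace hfS : ∀ i, f i ∈ closureUnits F S := fun i => hfS ⟨i, rfl⟩
  clear hfin
  -- Induction on a finite set of primes occurring in the local equations: each step splits off one
  -- prime with a global exponent. With no primes left, all local equations are units.
  induction S, hS using Set.Finite.induction_on generalizing f with
  | empty =>
    refine ⟨1, fun i => ?_⟩
    rw [div_one]
    exact closureUnits_le_unitsAtPrime (by simp) (hfS i)
  | @insert p S _ _ ih =>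
    have hp : Prime p := hSp p (Set.mem_insert _ _)
    replace ih := fun f hf => ih f hf fun q hq => hSp q (Set.mem_insert_of_mem _ hq)
    have hp0 : algebraMap A F p ≠ 0 :=
      (map_ne_zero_iff _ (IsFractionRing.injective A F)).2 hp.ne_zero
    -- A prime associated to one already in S contributes nothing new; otherwise the functions
    -- generated by S and the units are units at (p).
    by_cases hass : ∃ q ∈ S, p ∣ q
    · obtain ⟨q, hq, hpq⟩ := hass
      obtain ⟨v, hv⟩ := (hp.associated_of_dvd (hSp q (Set.mem_insert_of_mem _ hq)) hpq).symm
      refine ih f hf fun i => ?_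
      have hq0 : algebraMap A F q ≠ 0 := (map_ne_zero_iff _ (IsFractionRing.injective A F)).2
        (hSp q (Set.mem_insert_of_mem _ hq)).ne_zero
      have hle : closureUnits F (insert p S) ≤ closureUnits F S := by
        refine (Subgroup.closure_le _).2 ?_
        rintro f ⟨a, ha | rfl | ha, hf⟩
        · exact Subgroup.subset_closure ⟨a, Or.inl ha, hf⟩
        · rw [show f = Units.mk0 _ hq0 * Units.map (algebraMap A F).toMonoidHom v from
            Units.ext (by rw [hf, ← hv, map_mul]; rfl)]
          exact mul_mem (Subgroup.subset_closure ⟨q, Or.inr hq, rfl⟩)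
            (Subgroup.subset_closure ⟨v, Or.inl v.isUnit, rfl⟩)
        · exact Subgroup.subset_closure ⟨a, Or.inr ha, hf⟩
      exact hle (hfS i)
    · push Not at hass
      let π : Fˣ := Units.mk0 _ hp0
      have hspan : (Ideal.span {p}).IsPrime := (Ideal.span_singleton_prime hp.ne_zero).2 hp
      choose g hg m hgm using fun i =>
        exists_eq_mul_zpow_of_mem_closureUnits (π := π) rfl (hfS i)
      have hgp : ∀ i, g i ∈ unitsAtPrime F (Ideal.span {p}) := fun i =>
        closureUnits_le_unitsAtPrime
          (fun q hq h => hass q hq (Ideal.mem_span_singleton.1 h)) (hg i)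
      -- The exponent of p is the same at all Q i containing p: stability under generization puts
      -- (p) itself in the family, and all those local equations agree at (p) up to units. Where p ∉
      -- Q i, powers of p are units and any exponent will do.
      obtain ⟨N, hN⟩ : ∃ N : ℤ, ∀ i, f i / (g i * π ^ N) ∈ unitsAtPrime F (Q i) := by
        have hnot : ∀ i, p ∉ Q i → ∀ N : ℤ, f i / (g i * π ^ N) ∈ unitsAtPrime F (Q i) := by
          intro i hi N
          rw [hgm i, mul_div_mul_left_eq_div, div_eq_mul_inv, ← zpow_sub]
          have hπ : π ∈ unitsAtPrime F (Q i) :=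
            ⟨p, 1, hi, (Q i).one_notMem, by rw [map_one, mul_one]; rfl⟩
          exact zpow_mem hπ _
        by_cases hex : ∃ i, p ∈ Q i
        · obtain ⟨i₀, hi₀⟩ := hex
          refine ⟨m i₀, fun i => ?_⟩
          by_cases hi : p ∈ Q i
          · obtain ⟨i', hi'⟩ := hQ i (Ideal.span {p}) hspan
              ((Ideal.span_singleton_le_iff_mem _).2 hi)
            have hcmp : ∀ i, p ∈ Q i → f i / f i' ∈ unitsAtPrime F (Ideal.span {p}) := by
              intro i hi
              have := hf i i' (by rw [hi']; exact (Ideal.span_singleton_le_iff_mem _).2 hi)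
              simpa only [hi'] using this
            have h1 := div_mem (div_mem (hcmp i hi) (hcmp i₀ hi₀)) (div_mem (hgp i) (hgp i₀))
            rw [div_div_div_cancel_right, hgm i, hgm i₀, mul_div_mul_comm, mul_div_cancel_left,
              div_eq_mul_inv, ← zpow_sub] at h1
            have h2 := eq_zero_of_zpow_mem_unitsAtPrime rfl h1
            rw [← sub_eq_zero.1 h2, ← hgm i, div_self']
            exact one_mem _
          · exact hnot i hi _
        · push Not at hex
          exact ⟨0, fun i => hnot i (hex i) 0⟩
      -- After removing the common factor π ^ N, the functions g i satisfy the same compatibility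
      -- and involve only the primes in S.
      obtain ⟨h, hh⟩ := ih g (fun i i' hle => by
        have h1 := div_mem (hf i i' hle) (div_mem (unitsAtPrime_mono hle (hN i)) (hN i'))
        rwa [div_div_div_comm, div_div_cancel, div_div_cancel, mul_div_mul_right_eq_div] at h1) hg
      refine ⟨h * π ^ N, fun i => ?_⟩
      have h1 := mul_mem (hN i) (hh i)
      rwa [show f i / (g i * π ^ N) * (g i / h) = f i / (h * π ^ N) by
        rw [div_mul_div_comm, mul_assoc, mul_comm (f i), mul_comm (π ^ N) h,
          mul_div_mul_left_eq_div]] at h1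

end UniqueFactorizationMonoid
end

/-! ### The generic fibre as a set of primes of K(X)[T] -/

noncomputable section

namespace AlgebraicGeometry

namespace AffineSpace

open Scheme UniqueFactorizationMonoid

variable {n : Type u} {X Y : Scheme.{u}} (j : Y ⟶ 𝔸(n; X)) [IsOpenImmersion j]
  [IsIntegral X] [IsIntegral Y]

/-- Polynomials over the function field of the base as germs at a point of the generic fibre. -/
def fibrePolyStalk {z : Y} (hz : baseHom j z = genericPoint X) :
    MvPolynomial n X.functionField →+* Y.presheaf.stalk z :=
  (stalkPolyStalk j z).comp
    (MvPolynomial.map (X.presheaf.stalkSpecializes (specializes_of_eq hz)).hom)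

lemma algebraMap_fibrePolyStalk {z : Y} (hz : baseHom j z = genericPoint X)
    (g : MvPolynomial n X.functionField) :
    algebraMap _ Y.functionField (fibrePolyStalk j hz g) = polyFunctionField j g := by
  rw [fibrePolyStalk, RingHom.comp_apply, algebraMap_stalkPolyStalk, MvPolynomial.map_map]
  congr 1
  have h1 : (algebraMap (X.presheaf.stalk (baseHom j z)) X.functionField).comp
      (X.presheaf.stalkSpecializes (specializes_of_eq hz)).hom = RingHom.id X.functionField :=
    RingHom.ext fun r => (algebraMap_stalkSpecializes (specializes_of_eq hz) r).trans
      congr($(TopCat.Presheaf.stalkSpecializes_refl X.presheaf (genericPoint X)) r)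
  rw [h1, MvPolynomial.map_id]

lemma polyRat_eq (W : X.Opens) [Nonempty W] (g : MvPolynomial n Γ(X, W)) :
    polyRat j W g = polyFunctionField j (MvPolynomial.map (X.germToFunctionField W).hom g) :=
  rfl

lemma polyStalk_eq_fibrePolyStalk {W : X.Opens} [Nonempty W] {z : Y} (hz : baseHom j z ∈ W)
    (hz' : baseHom j z = genericPoint X) (g : MvPolynomial n Γ(X, W)) :
    polyStalk j hz g =
      fibrePolyStalk j hz' (MvPolynomial.map (X.germToFunctionField W).hom g) := by
  apply algebraMap_stalk_injective
  rw [algebraMap_fibrePolyStalk, algebraMap_polyStalk, polyRat_eq]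

variable (X) in
lemma exists_isAffineOpen_genericPoint_mem :
    ∃ W : X.Opens, IsAffineOpen W ∧ genericPoint X ∈ W := by
  obtain ⟨_, ⟨W, hW, rfl⟩, h, -⟩ := X.isBasis_affineOpens.exists_subset_of_mem_open
    (Set.mem_univ (genericPoint X)) isOpen_univ
  exact ⟨W, hW, h⟩

lemma exists_C_mul_eq_map_germToFunctionField {W : X.Opens} [Nonempty W] (hW : IsAffineOpen W)
    (g : MvPolynomial n X.functionField) : ∃ (c : X.functionField) (a : MvPolynomial n Γ(X, W)),
      c ≠ 0 ∧ MvPolynomial.C c * g = MvPolynomial.map (X.germToFunctionField W).hom a := by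
  have := functionField_isFractionRing_of_isAffineOpen X W hW
  obtain ⟨c, a, hc, h⟩ := exists_C_mul_eq_map (R := Γ(X, W)) g
  exact ⟨_, a, (map_ne_zero_iff _ (X.germToFunctionField_injective W)).2 hc, h⟩

lemma polyFunctionField_injective : Function.Injective (polyFunctionField j) := by
  rw [injective_iff_map_eq_zero]
  intro g hg
  obtain ⟨W, hW, hη⟩ := exists_isAffineOpen_genericPoint_mem X
  have : Nonempty W := ⟨⟨_, hη⟩⟩
  obtain ⟨c, a, hc, h⟩ := exists_C_mul_eq_map_germToFunctionField hW g
  have h1 : polyRat j W a = 0 := by rw [polyRat_eq, ← h, map_mul, hg, mul_zero]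
  rw [map_eq_zero_iff _ (polyRat_injective j hW)] at h1
  rw [h1, map_zero] at h
  refine (mul_eq_zero.1 h).resolve_left ?_
  exact (map_ne_zero_iff _ (MvPolynomial.C_injective n _)).2 hc

/-- The function field of an open subscheme of affine space is the field of rational functions
over the function field of the base. -/
lemma isFractionRing_polyFunctionField :
    letI := (polyFunctionField j).toAlgebra
    IsFractionRing (MvPolynomial n X.functionField) Y.functionField := by
  let := (polyFunctionField j).toAlgebra
  have : FaithfulSMul (MvPolynomial n X.functionField) Y.functionField :=
    (faithfulSMul_iff_algebraMap_injective _ _).2 (polyFunctionField_injective j)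
  refine IsFractionRing.of_field _ _ fun f => ?_
  obtain ⟨W, hW, hη⟩ := exists_isAffineOpen_genericPoint_mem X
  have : Nonempty W := ⟨⟨_, hη⟩⟩
  have hy : baseHom j (genericPoint Y) ∈ W := by rwa [baseHom_genericPoint]
  by_cases h : f = 0
  · exact ⟨0, 1, by rw [h, map_zero, zero_div]⟩
  obtain ⟨t, ht : f = _⟩ := exists_eq_algebraMap_of_mem_unitsAt
    (mem_unitsAt_genericPoint (X := Y) (Units.mk0 f h))
  obtain ⟨a, s, hs, has⟩ := exists_mul_polyStalk_eq j hW hy t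
  refine ⟨MvPolynomial.map (X.germToFunctionField W).hom a,
    MvPolynomial.map (X.germToFunctionField W).hom s, ?_⟩
  change f = polyRat j W a / polyRat j W s
  rw [← algebraMap_polyStalk j hy, ← algebraMap_polyStalk j hy, eq_div_iff, ht, ← map_mul, has]
  exact (hs.map _).ne_zero

/-- The ideal of a point of the generic fibre. -/
def fibreIdeal {z : Y} (hz : baseHom j z = genericPoint X) :
    Ideal (MvPolynomial n X.functionField) :=
  (IsLocalRing.maximalIdeal (Y.presheaf.stalk z)).comap (fibrePolyStalk j hz)

instance {z : Y} (hz : baseHom j z = genericPoint X) : (fibreIdeal j hz).IsPrime :=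
  inferInstanceAs (Ideal.comap _ _).IsPrime

lemma notMem_fibreIdeal {z : Y} (hz : baseHom j z = genericPoint X)
    {g : MvPolynomial n X.functionField} :
    g ∉ fibreIdeal j hz ↔ IsUnit (fibrePolyStalk j hz g) := by
  rw [fibreIdeal, Ideal.mem_comap, IsLocalRing.mem_maximalIdeal, mem_nonunits_iff, not_not]

/-- The dictionary with the factorial ring K(X)[T]: germs of divisors at points of the generic fibre
become classes modulo units at primes. -/
lemma unitsAt_eq_unitsAtPrime {z : Y} (hz : baseHom j z = genericPoint X) :
    letI := (polyFunctionField j).toAlgebra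
    unitsAtPrime Y.functionField (fibreIdeal j hz) = Y.unitsAt z := by
  let := (polyFunctionField j).toAlgebra
  apply le_antisymm
  · rintro f ⟨a, b, ha, hb, hab⟩
    rw [notMem_fibreIdeal] at ha hb
    obtain ⟨v, hv⟩ := hb
    refine mem_unitsAt_of_isUnit (ha.mul v⁻¹.isUnit) ?_
    change _ * polyFunctionField j b = polyFunctionField j a at hab
    rw [← algebraMap_fibrePolyStalk j hz, ← algebraMap_fibrePolyStalk j hz, ← hv] at hab
    rw [map_mul, ← hab, mul_assoc, ← map_mul, Units.mul_inv, map_one, mul_one]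
  · rintro _ ⟨t, rfl⟩
    obtain ⟨W, hW, hη⟩ := exists_isAffineOpen_genericPoint_mem X
    have : Nonempty W := ⟨⟨_, hη⟩⟩
    have hy : baseHom j z ∈ W := by rwa [hz]
    obtain ⟨a, s, hs, has⟩ := exists_mul_polyStalk_eq j hW hy (t : Y.presheaf.stalk z)
    have ha : IsUnit (polyStalk j hy a) := has ▸ t.isUnit.mul hs
    refine ⟨_, _, (notMem_fibreIdeal j hz).2 (polyStalk_eq_fibrePolyStalk j hy hz a ▸ ha),
      (notMem_fibreIdeal j hz).2 (polyStalk_eq_fibrePolyStalk j hy hz s ▸ hs), ?_⟩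
    change algebraMap _ _ (t : Y.presheaf.stalk z) * polyRat j W s = polyRat j W a
    rw [← algebraMap_polyStalk j hy, ← algebraMap_polyStalk j hy, ← map_mul, has]

lemma specializes_of_fibreIdeal_le {z z' : Y} (hz : baseHom j z = genericPoint X)
    (hz' : baseHom j z' = genericPoint X) (h : fibreIdeal j hz' ≤ fibreIdeal j hz) : z' ⤳ z := by
  obtain ⟨W, hW, hη⟩ := exists_isAffineOpen_genericPoint_mem X
  have : Nonempty W := ⟨⟨_, hη⟩⟩
  refine specializes_of_isUnit_imp j hW (y := z) (z := z') (by rwa [hz]) (by rwa [hz']) fun g => ?_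
  rw [polyStalk_eq_fibrePolyStalk j _ hz, polyStalk_eq_fibrePolyStalk j _ hz',
    ← notMem_fibreIdeal, ← notMem_fibreIdeal]
  exact fun hg hg' => hg (h hg')

/-- The prime P is contracted to polynomials over Γ(X, W). Nothing is lost, because every polynomial
over K(X) becomes such a polynomial after scaling by a nonzero, hence invertible, constant. -/
lemma exists_fibreIdeal_eq {z : Y} (hz : baseHom j z = genericPoint X)
    (P : Ideal (MvPolynomial n X.functionField)) [hP : P.IsPrime] (h : P ≤ fibreIdeal j hz) :
    ∃ (z' : Y) (hz' : baseHom j z' = genericPoint X), fibreIdeal j hz' = P := by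
  obtain ⟨W, hW, hη⟩ := exists_isAffineOpen_genericPoint_mem X
  have : Nonempty W := ⟨⟨_, hη⟩⟩
  have hy : baseHom j z ∈ W := by rwa [hz]
  obtain ⟨z', hz'W, hsp, hz'P⟩ := exists_specializes_of_isPrime j hW hy
    (P.comap (MvPolynomial.map (σ := n) (X.germToFunctionField W).hom)) fun g hg hu =>
      (notMem_fibreIdeal j hz).2 (polyStalk_eq_fibrePolyStalk j hy hz g ▸ hu) (h hg)
  have hz' : baseHom j z' = genericPoint X :=
    Specializes.antisymm ((hsp.map (baseHom j).continuous).trans (specializes_of_eq hz))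
      (genericPoint_specializes _) |>.eq
  refine ⟨z', hz', ?_⟩
  have key : ∀ (Q : Ideal (MvPolynomial n X.functionField)) (c : X.functionField)
      (g : MvPolynomial n X.functionField), c ≠ 0 → (MvPolynomial.C c * g ∈ Q ↔ g ∈ Q) :=
    fun Q c g hc => Ideal.unit_mul_mem_iff_mem Q ((isUnit_iff_ne_zero.2 hc).map MvPolynomial.C)
  ext g
  obtain ⟨c, a, hc, hca⟩ := exists_C_mul_eq_map_germToFunctionField hW g
  rw [← key _ c g hc, ← key P c g hc, hca, ← not_iff_not, notMem_fibreIdeal,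
    ← polyStalk_eq_fibrePolyStalk j hz'W hz', hz'P]
  rfl

/-- A divisor on an open subscheme of affine space becomes trivial on the generic fibre after
multiplication by a principal divisor. -/
theorem exists_mul_principalDivisor_eq_one [TopologicalSpace.NoetherianSpace Y]
    (D : Y.cartierDivisors) : ∃ h : Y.functionFieldˣ,
      ∀ z, baseHom j z = genericPoint X → (D * Y.principalDivisor h).1 z = 1 := by
  let := (polyFunctionField j).toAlgebra
  have hfrac : IsFractionRing (MvPolynomial n X.functionField) Y.functionField :=
    isFractionRing_polyFunctionField j
  choose N hN f hf using D.2
  -- Quasi-compactness leaves finitely many local equations, so only finitely many primes of K(X)[T]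
  -- can occur in them.
  obtain ⟨T, hT⟩ := (TopologicalSpace.NoetherianSpace.isCompact (Set.univ : Set Y)).elim_nhds_subcover
    (fun z => (N z : Set Y)) fun z _ => (N z).2.mem_nhds (hN z)
  have hT' : ∀ z, ∃ t ∈ T, z ∈ N t := fun z => by
    simpa using hT.2 (Set.mem_univ z)
  choose c hcT hc using hT'
  let ι := {z : Y // baseHom j z = genericPoint X}
  obtain ⟨h, hh⟩ := exists_div_mem_unitsAtPrime (F := Y.functionField)
    (fun i : ι => fibreIdeal j i.2)
    (fun i P hP hle => by
      obtain ⟨z', hz', h⟩ := exists_fibreIdeal_eq j i.2 P hle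
      exact ⟨⟨z', hz'⟩, h⟩)
    (fun i => f (c i.1))
    ((T.finite_toSet.image f).subset (by
      rintro _ ⟨i, rfl⟩
      exact ⟨_, hcT _, rfl⟩))
    (fun i i' hle => by
      have hsp := specializes_of_fibreIdeal_le j i.2 i'.2 hle
      rw [unitsAt_eq_unitsAtPrime, ← inv_mem_iff, ← divisorGerm_eq_one_iff, inv_div, div_eq_inv_mul,
        divisorGerm_eq_one_iff, ← divisorGerm_eq_iff, ← hf _ i'.1 (hc i'.1),
        ← hf _ i'.1 (hsp.mem_open (N _).2 (hc i.1))])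
  refine ⟨h⁻¹, fun z hz => ?_⟩
  have h1 := hh ⟨z, hz⟩
  rw [unitsAt_eq_unitsAtPrime, ← divisorGerm_eq_one_iff] at h1
  change D.1 z * Y.divisorGerm z h⁻¹ = 1
  rw [hf _ z (hc z), ← map_mul, ← div_eq_mul_inv, h1]

end AffineSpace

end AlgebraicGeometry
end

/-! ### The isomorphism of Picard groups -/

noncomputable section

namespace AlgebraicGeometry

namespace AffineSpace

open Scheme

variable {n : Type u} {X Y : Scheme.{u}} (j : Y ⟶ 𝔸(n; X)) [IsOpenImmersion j]
  [IsIntegral X] [IsIntegral Y] (β : X ⟶ Y)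

lemma picMap_section_picMap_baseHom (hβ : β ≫ baseHom j = 𝟙 X) :
    (picMap β).comp (picMap (baseHom j)) = MonoidHom.id X.Pic := by
  rw [← picMap_comp, hβ, picMap_id]

/-- A class has a representative trivial on the generic fibre, and this representative is the
pullback of its restriction to the section. -/
lemma picMap_baseHom_surjective [Finite n] [∀ x, IsIntegrallyClosed (X.presheaf.stalk x)]
    [TopologicalSpace.NoetherianSpace Y] (hβ : β ≫ baseHom j = 𝟙 X) :
    Function.Surjective (picMap (baseHom j)) := by
  intro c
  obtain ⟨D, rfl⟩ := QuotientGroup.mk'_surjective _ c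
  obtain ⟨h, hgen⟩ := exists_mul_principalDivisor_eq_one j D
  refine ⟨X.divisorClass (pullbackDivisor β ⟨_, mem_divisorsAvoiding_section j β hβ hgen⟩), ?_⟩
  have h1 := picMap_divisorClass (baseHom j)
    ⟨pullbackDivisor β ⟨_, mem_divisorsAvoiding_section j β hβ hgen⟩,
      mem_divisorsAvoiding_baseHom j _⟩
  rw [pullbackDivisor_baseHom_pullbackDivisor_section j β hβ _ hgen, map_mul,
    divisorClass_principal, mul_one] at h1
  exact h1

/-- The Picard group of an integral normal scheme is isomorphic to the Picard group of any open
subscheme of an affine space over it that has a section. -/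
theorem exists_picEquiv [Finite n] [∀ x, IsIntegrallyClosed (X.presheaf.stalk x)]
    [TopologicalSpace.NoetherianSpace Y] (hβ : β ≫ baseHom j = 𝟙 X) :
    ∃ e : X.Pic ≃* Y.Pic,
      e.toMonoidHom = picMap (baseHom j) ∧ e.symm.toMonoidHom = picMap β := by
  have h1 := picMap_section_picMap_baseHom j β hβ
  have h2 : (picMap (baseHom j)).comp (picMap β) = MonoidHom.id Y.Pic := by
    ext c
    obtain ⟨c, rfl⟩ := picMap_baseHom_surjective j β hβ c
    exact congrArg (picMap (baseHom j)) (DFunLike.congr_fun h1 c)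
  exact ⟨MonoidHom.toMulEquiv _ _ h1 h2, rfl, rfl⟩

end AffineSpace

lemma IsAffineOpen.isIntegrallyClosed_stalk {X : Scheme.{u}} [IsIntegral X] {V : X.Opens}
    (hV : IsAffineOpen V) (x : V) [IsIntegrallyClosed Γ(X, V)] :
    IsIntegrallyClosed (X.presheaf.stalk x.1) := by
  have : Nonempty V := ⟨x⟩
  have hloc := hV.isLocalization_stalk x
  exact isIntegrallyClosed_of_isLocalization (X.presheaf.stalk x.1)
    (hV.primeIdealOf x).asIdeal.primeCompl (Ideal.primeCompl_le_nonZeroDivisors _)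

/-- The local rings of an integral smooth scheme over a field are integrally closed. -/
lemma isIntegrallyClosed_stalk_of_smooth {k : Type u} [Field k] {X : Scheme.{u}} [IsIntegral X]
    (s : X ⟶ Spec (.of k)) [Smooth s] (x : X) : IsIntegrallyClosed (X.presheaf.stalk x) := by
  obtain ⟨_, ⟨W, hW, rfl⟩, hx, -⟩ := X.isBasis_affineOpens.exists_subset_of_mem_open
    (Set.mem_univ x) isOpen_univ
  replace hx : x ∈ W := hx
  have : Nonempty W := ⟨⟨x, hx⟩⟩
  have hsm := s.smooth_appLE (isAffineOpen_top (Spec (.of k))) hW (le_top (a := W))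
  -- The global sections of Spec k are only isomorphic to k, so their field structure is transported
  -- before the algebraic statement applies.
  have hk : IsField Γ(Spec (.of k), ⊤) :=
    (Scheme.ΓSpecIso (.of k)).commRingCatIsoToRingEquiv.isField (Field.toIsField k)
  let := hk.toField
  let := (s.appLE ⊤ W le_top).hom.toAlgebra
  have : Algebra.Smooth Γ(Spec (.of k), ⊤) Γ(X, W) := hsm
  have := isIntegrallyClosed_of_smooth Γ(Spec (.of k), ⊤) Γ(X, W)
  exact hW.isIntegrallyClosed_stalk ⟨x, hx⟩

end AlgebraicGeometry

theorem mainTheorem3 {k : Type u} [Field k] [IsAlgClosed k]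
    (X : Scheme.{u}) (s : X ⟶ Spec (.of k))
    [IsIntegral X] [IsSeparated s] [LocallyOfFiniteType s] [QuasiCompact s] [Smooth s]
    (d : ℕ) (U : (affineSpaceOver k d).Opens) [Nonempty U]
    (u₀ : Spec (.of k) ⟶ (U : Scheme.{u})) (hu₀ : u₀ ≫ openAffineSpaceHom U = 𝟙 _) :
    let α : pullback s (openAffineSpaceHom U) ⟶ X := pullback.fst s (openAffineSpaceHom U)
    let β : X ⟶ pullback s (openAffineSpaceHom U) :=
      pullback.lift (𝟙 X) (s ≫ u₀) (by rw [Category.assoc, hu₀, Category.comp_id, Category.id_comp])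
    ∃ e : X.Pic ≃* (pullback s (openAffineSpaceHom U)).Pic,
      e.toMonoidHom = Scheme.picMap α ∧ e.symm.toMonoidHom = Scheme.picMap β := by
  intro α β
  -- Affine space over X is the product of X with affine space over k; composing with this
  -- identification makes X × U open in affine space over X.
  let e := (IsPullback.of_hasPullback s (affineSpaceOver k d ↘ Spec (.of k))).isoIsPullback _ _
    (AffineSpace.isPullback_map (n := ULift.{u} (Fin d)) s).flip
  let j : pullback s (openAffineSpaceHom U) ⟶ 𝔸(ULift.{u} (Fin d); X) :=
    pullback.map s (openAffineSpaceHom U) s (affineSpaceOver k d ↘ Spec (.of k)) (𝟙 X) U.ι (𝟙 _)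
      (by simp) (by simp) ≫ e.hom
  have hj : AffineSpace.baseHom j = α := by
    have h1 : e.hom ≫ (𝔸(ULift.{u} (Fin d); X) ↘ X) = pullback.fst _ _ :=
      IsPullback.isoIsPullback_hom_fst _ _ _ _
    rw [AffineSpace.baseHom, Category.assoc, h1]
    exact (pullback.lift_fst _ _ _).trans (Category.comp_id _)
  have hβ : β ≫ AffineSpace.baseHom j = 𝟙 X := by
    rw [hj]
    exact pullback.lift_fst _ _ _
  have hnormal : ∀ x, IsIntegrallyClosed (X.presheaf.stalk x) :=
    isIntegrallyClosed_stalk_of_smooth s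
  -- Affine space being locally Noetherian makes the open U quasi-compact over k; so X × U is of
  -- finite type over k and Noetherian.
  have hA : IsLocallyNoetherian (affineSpaceOver k d) :=
    LocallyOfFiniteType.isLocallyNoetherian (affineSpaceOver k d ↘ Spec (.of k))
  have hq : QuasiCompact (openAffineSpaceHom U) := inferInstance
  have hloc : IsLocallyNoetherian (pullback s (openAffineSpaceHom U)) :=
    LocallyOfFiniteType.isLocallyNoetherian (pullback.fst s (openAffineSpaceHom U) ≫ s)
  have hcomp : CompactSpace ↥(pullback s (openAffineSpaceHom U)) :=
    QuasiCompact.compactSpace_of_compactSpace (pullback.fst s (openAffineSpaceHom U) ≫ s)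
  have hnoeth : IsNoetherian (pullback s (openAffineSpaceHom U)) := { }
  rw [← hj]
  exact AffineSpace.exists_picEquiv j β hβ
end
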